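/- Let $d\ge 1$, $T>0$, $\beta>0$, $\theta>0$, and let $\Lambda=(\mathbb R/\mathbb Z)^d$ be the unit torus with Lebesgue measure $dr$. Let $J\in C^1(\Lambda)$ be real-valued (of any sign) with $J(-r)=J(r)$ and $\int_\Lambda J(r)\,dr=1$. Let $a_1\ne a_2$ be real numbers, let $p_1+p_2=1$, and let $\alpha=(\alpha(x))_{x\in\mathbb Z^d}$ be i.i.d. random variables on a probability space with law $\mathbb P$, such that $\mathbb P(\alpha(x)=a_i)=p_i$, $i=1,2$. For $\gamma\in(0,1]$ with $\gamma^{-1}$ an odd integer, let $\Lambda_\gamma=\mathbb Z^d/\gamma^{-1}\mathbb Z^d$, identified with the box of side $\gamma^{-1}$ centred at the origin, so that $\alpha$ induces a field on $\Lambda_\gamma$. For $\sigma\in\{-1,+1\}^{\Lambda_\gamma}$ let $$H^{\gamma,\alpha}(\sigma)=-\tfrac12\sum_{x,y\in\Lambda_\gamma}\gamma^dJ(\gamma(x-y))\sigma(x)\sigma(y)-\theta\sum_{x\in\Lambda_\gamma}\alpha(x)\sigma(x).$$ Let $\sigma^x$ be $\sigma$ with the spin at $x$ flipped, and set $$c_x^{\gamma,\alpha}(\sigma)=\frac{\exp[-\frac\beta2(H^{\gamma,\alpha}(\sigma^x)-H^{\gamma,\alpha}(\sigma))]}{2\cosh[\frac\beta2(H^{\gamma,\alpha}(\sigma^x)-H^{\gamma,\alpha}(\sigma))]},\qquad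 \mathcal L^{\gamma,\alpha}f(\sigma)=\sum_{x\in\Lambda_\gamma}c_x^{\gamma,\alpha}(\sigma)[f(\sigma^x)-f(\sigma)].$$ Let $m_0:\Lambda\to[-1,1]$ be continuous, and let $\sigma^\gamma\in\{-1,+1\}^{\Lambda_\gamma}$ be deterministic configurations, not depending on $\alpha$, such that for every $H\in C(\Lambda)$ $$\gamma^d\sum_{x\in\Lambda_\gamma}\sigma^\gamma(x)H(\gamma x)\longrightarrow\int_\Lambda H(r)\,m_0(r)\,dr\qquad(\gamma\to0).$$ Let $P^{\gamma,\alpha}_{\sigma^\gamma}$ be the law on $D([0,T],\{-1,+1\}^{\Lambda_\gamma})$ of the continuous-time Markov chain $(\sigma_t)_{t\in[0,T]}$ with generator $\mathcal L^{\gamma,\alpha}$ started from $\sigma^\gamma$. For $\bar G=(G_1,G_2)$ set $$\langle\bar\pi^\gamma_t,\bar G\rangle=\sum_{i=1,2}\gamma^d\sum_{x\in\Lambda_\gamma}G_i(\gamma x)\mathbf 1_{\{\alpha(x)=a_i\}}\sigma_t(x).$$ **Theorem.** The Cauchy problem on $[0,T]\times\Lambda$, for $i=1,2$, $$\partial_tm_i=-m_i+p_i\tanh[\beta((J*m)+a_i\theta)],\qquad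 m=m_1+m_2,\qquad m_i(0,\cdot)=p_im_0,$$ where $(J*m)(t,r)=\int_\Lambda J(r-r')m(t,r')\,dr'$, has a weak solution $\bar m=(m_1,m_2)$, and it is unique: any two weak solutions agree, for every $t\in[0,T]$, for almost every $r$. Here a weak solution is a pair $\bar m$, bounded in $L^\infty(\Lambda)$ uniformly in $t\in[0,T]$, with $t\mapsto\int_\Lambda H(r)m_i(t,r)\,dr$ continuous on $[0,T]$ for all $H\in C(\Lambda)$, such that for $i=1,2$, for all $t\in[0,T]$ and all continuous $G$ on $[0,T]\times\Lambda$ having a continuous time derivative $\partial_sG$, $$\int_\Lambda G(t,r)m_i(t,r)\,dr-\int_\Lambda G(0,r)p_im_0(r)\,dr-\int_0^t\!\!\int_\Lambda\partial_sG\,m_i\,dr\,ds=\int_0^t\!\!\int_\Lambda G\,\bigl\{-m_i+p_i\tanh[\beta((J*m)+a_i\theta)]\bigr\}\,dr\,ds.$$ Moreover, for $\mathbb P$-almost every $\alpha$: for all $t\in[0,T]$, all $\delta>0$ and all $\bar G=(G_1,G_2)\in(C^1(\Lambda))^2$, $$\lim_{\gamma\to0}P^{\gamma,\alpha}_{\sigma^\gamma}\Bigl[\Bigl|\langle\bar\pi^\gamma_t,\bar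 G\rangle-\sum_{i=1,2}\int_\Lambda G_i(r)m_i(t,r)\,dr\Bigr|\ge\delta\Bigr]=0 .$$ -/

import Mathlib

open MeasureTheory Filter Topology

/-- The `d`-dimensional unit torus `Λ = (ℝ/ℤ)^d`; its `volume` is the normalized Lebesgue measure. -/
abbrev Torus (d : ℕ) : Type := Fin d → UnitAddCircle

/-- Continuously differentiable real functions on the torus: the `ℤ^d`-periodic lift to `ℝ^d`
is of class `C^1`. -/
def TorusC1 {d : ℕ} (G : Torus d → ℝ) : Prop :=
  ContDiff ℝ 1 (fun x : Fin d → ℝ => G (fun j => (x j : UnitAddCircle)))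

/-- The discrete torus `Λ_γ = ℤ^d / γ⁻¹ℤ^d`, where `γ = 1 / n`. -/
abbrev DiscTorus (d n : ℕ) : Type := Fin d → ZMod n

/-- Spin configurations `{-1, +1}^{Λ_γ}` (`ℤˣ` is the set `{-1, +1}`). -/
abbrev SpinConfig (d n : ℕ) : Type := DiscTorus d n → ℤˣ

/-- The value `σ(x) ∈ {-1, +1}` as a real number. -/
def spin {d n : ℕ} (σ : SpinConfig d n) (x : DiscTorus d n) : ℝ := ((σ x : ℤ) : ℝ)

/-- The configuration `σ^x` obtained from `σ` by flipping the spin at `x`. -/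
def flipSpin {d n : ℕ} (σ : SpinConfig d n) (x : DiscTorus d n) : SpinConfig d n :=
  Function.update σ x (-σ x)

/-- The rescaled site `γ x ∈ Λ`, where `γ = 1 / n`. -/
noncomputable def scaledSite {d n : ℕ} [NeZero n] (x : DiscTorus d n) : Torus d :=
  fun j => ZMod.toAddCircle (x j)

/-- The field on `Λ_γ` induced by a field on `ℤ^d`: a site of `Λ_γ` is identified with its
representative in the box `[-(n - 1) / 2, (n - 1) / 2]^d` centred at the origin (`n` is odd). -/
def inducedField {d : ℕ} (n : ℕ) (α : (Fin d → ℤ) → ℝ) (x : DiscTorus d n) : ℝ :=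
  α (fun j => (x j).valMinAbs)

/-- The Kac potential `J_γ(x, y) = γ^d J(γ(x - y))`. -/
noncomputable def kacPotential {d n : ℕ} [NeZero n] (J : Torus d → ℝ)
    (x y : DiscTorus d n) : ℝ :=
  ((n : ℝ)⁻¹) ^ d * J (scaledSite (x - y))

/-- The Hamiltonian
`H(σ) = -1/2 ∑_{x,y} J_γ(x,y) σ(x) σ(y) - θ ∑_x α(x) σ(x)`. -/
noncomputable def hamiltonian {d n : ℕ} [NeZero n] (J : Torus d → ℝ) (θ : ℝ)
    (α : (Fin d → ℤ) → ℝ) (σ : SpinConfig d n) : ℝ :=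
  -(1 / 2) * (∑ x, ∑ y, kacPotential J x y * spin σ x * spin σ y)
    - θ * ∑ x, inducedField n α x * spin σ x

/-- The flip rate
`c_x(σ) = exp(-(β/2) ΔH) / (2 cosh((β/2) ΔH))`, `ΔH = H(σ^x) - H(σ)`. -/
noncomputable def flipRate {d n : ℕ} [NeZero n] (β : ℝ) (J : Torus d → ℝ) (θ : ℝ)
    (α : (Fin d → ℤ) → ℝ) (x : DiscTorus d n) (σ : SpinConfig d n) : ℝ :=
  Real.exp (-(β / 2) * (hamiltonian J θ α (flipSpin σ x) - hamiltonian J θ α σ)) /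
    (2 * Real.cosh ((β / 2) * (hamiltonian J θ α (flipSpin σ x) - hamiltonian J θ α σ)))

/-- The generator of the Glauber dynamics, `L f(σ) = ∑_x c_x(σ) (f(σ^x) - f(σ))`. -/
noncomputable def glauberGenerator {d n : ℕ} [NeZero n] (β : ℝ) (J : Torus d → ℝ) (θ : ℝ)
    (α : (Fin d → ℤ) → ℝ) : (SpinConfig d n → ℝ) →ₗ[ℝ] (SpinConfig d n → ℝ) where
  toFun f σ := ∑ x, flipRate β J θ α x σ * (f (flipSpin σ x) - f σ)
  map_add' f g := by
    funext σ
    simp only [Pi.add_apply, ← Finset.sum_add_distrib]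
    exact Finset.sum_congr rfl fun x _ => by ring
  map_smul' c f := by
    funext σ
    simp only [Pi.smul_apply, smul_eq_mul, RingHom.id_apply, Finset.mul_sum]
    exact Finset.sum_congr rfl fun x _ => by ring

/-- Right-continuous functions on `[0, T]` with left limits. -/
def IsCadlagPath {T : ℝ} {S : Type*} [TopologicalSpace S] (w : Set.Icc (0 : ℝ) T → S) : Prop :=
  ∀ t, ContinuousWithinAt w (Set.Ici t) t ∧ ∃ l, Tendsto w (𝓝[<] t) (𝓝 l)

/-- The path space `D([0, T], S)`, with the σ-field generated by the coordinate maps. -/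
abbrev CadlagPath (T : ℝ) (S : Type*) [TopologicalSpace S] : Type _ :=
  {w : Set.Icc (0 : ℝ) T → S // IsCadlagPath w}

/-- `μ` is the law on `D([0, T], S)` of the continuous-time Markov chain on the finite set `S`
with generator `L` started from `s₀`: its finite-dimensional distributions are those given by the
transition probabilities `exp(tL)(s, s')`. -/
structure IsMarkovChainLaw {S : Type*} [Fintype S] [DecidableEq S] [TopologicalSpace S]
    [MeasurableSpace S] {T : ℝ} (L : (S → ℝ) →ₗ[ℝ] (S → ℝ)) (s₀ : S)
    (μ : Measure (CadlagPath T S)) : Prop where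
  isProbabilityMeasure : IsProbabilityMeasure μ
  finiteDimensional : ∀ (m : ℕ) (t : Fin (m + 1) → Set.Icc (0 : ℝ) T) (s : Fin (m + 1) → S),
    Monotone t → (t 0 : ℝ) = 0 → s 0 = s₀ →
      μ.real {w | ∀ j, w.1 (t j) = s j} =
        ∏ j : Fin m, NormedSpace.exp
          (((t j.succ : ℝ) - (t j.castSucc : ℝ)) • LinearMap.toMatrix' L)
            (s j.castSucc) (s j.succ)

/-- The pairing `⟨π^γ(σ), G⟩ = γ^d ∑_x G(γx) σ(x)` of the empirical measure with `G`. -/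
noncomputable def empiricalPairing {d n : ℕ} [NeZero n] (σ : SpinConfig d n)
    (G : Torus d → ℝ) : ℝ :=
  ((n : ℝ)⁻¹) ^ d * ∑ x, G (scaledSite x) * spin σ x

open Classical in
/-- The pairing `⟨π̄^γ(σ), Ḡ⟩ = ∑_i γ^d ∑_x G_i(γx) 1{α(x) = a_i} σ(x)` of the colored
empirical measures with `Ḡ = (G_1, G_2)`. -/
noncomputable def coloredPairing {d n : ℕ} [NeZero n] (a : Fin 2 → ℝ)
    (α : (Fin d → ℤ) → ℝ) (σ : SpinConfig d n) (G : Fin 2 → Torus d → ℝ) : ℝ :=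
  ∑ i, ((n : ℝ)⁻¹) ^ d *
    ∑ x, G i (scaledSite x) * (if inducedField n α x = a i then 1 else 0) * spin σ x

/-- The convolution `(J * u)(r) = ∫_Λ J(r - r') u(r') dr'`. -/
noncomputable def torusConv {d : ℕ} (J u : Torus d → ℝ) (r : Torus d) : ℝ :=
  ∫ r', J (r - r') * u r'

/-- `m̄ = (m_1, m_2)` is a weak solution on `[0, T]` of
`∂_t m_i = -m_i + p_i tanh(β (J * m + a_i θ))`, `m = m_1 + m_2`, `m_i(0) = p_i m_0`.
The solution lies in `L^∞`, uniformly in time, and `t ↦ m_i(t) dr` is continuous in the weak-*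
topology; the test functions are of class `C^{1,0}` in `[0, T] × Λ`. -/
structure IsWeakSolution {d : ℕ} (T β : ℝ) (J : Torus d → ℝ) (θ : ℝ) (a p : Fin 2 → ℝ)
    (m₀ : Torus d → ℝ) (m : Fin 2 → ℝ → Torus d → ℝ) : Prop where
  aestronglyMeasurable : ∀ i, ∀ t ∈ Set.Icc 0 T, AEStronglyMeasurable (m i t) volume
  bounded : ∃ C : ℝ, ∀ i, ∀ t ∈ Set.Icc 0 T, ∀ᵐ r, |m i t r| ≤ C
  weakStarContinuous : ∀ i, ∀ H : Torus d → ℝ, Continuous H →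
    ContinuousOn (fun t => ∫ r, H r * m i t r) (Set.Icc 0 T)
  weakEquation : ∀ i, ∀ G G' : ℝ → Torus d → ℝ,
    ContinuousOn (Function.uncurry G) (Set.Icc 0 T ×ˢ Set.univ) →
    ContinuousOn (Function.uncurry G') (Set.Icc 0 T ×ˢ Set.univ) →
    (∀ r, ∀ s ∈ Set.Icc 0 T, HasDerivWithinAt (fun u => G u r) (G' s r) (Set.Icc 0 T) s) →
    ∀ t ∈ Set.Icc 0 T,
      (∫ r, G t r * m i t r) - (∫ r, G 0 r * (p i * m₀ r))
          - (∫ s in (0 : ℝ)..t, ∫ r, G' s r * m i s r) =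
        ∫ s in (0 : ℝ)..t, ∫ r, G s r *
          (-m i s r + p i * Real.tanh
            (β * (torusConv J (fun r' => m 0 s r' + m 1 s r') r + a i * θ)))

/-! Write g = γ^d. The flip rate at x is (1 - σ(x) tanh(β h_x(σ))) / 2, where h_x is the field at x
without self-interaction (`flipRate_eq`). Hence a linear statistic g ∑ b(x)σ(x) has drift -g ∑
b(x)σ(x) + g ∑ b(x) tanh(β h_x): the limit equation, except that h_x is still microscopic. The
system closes because, up to the self-interaction of order g, the field at a site z is the external
field plus another such statistic, with weight b = J(γ(z - ·)).

So let Φ_t be the average over z of the squared deviation of the local field from (J * m)(t, γz),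
plus the squared deviation of the colored pairing with Ḡ, plus a constant η. Since tanh is
1-Lipschitz, LΦ_t + ∂_tΦ_t ≤ CΦ_t once η dominates three errors: the self-interaction, the jump
variance (both vanish with g), and the gap between averages over sites of color i and p_i times an
integral. Grönwall for expectations (`sum_exp_mul_le_exp_mul`, used in `sum_exp_mul_sq_le`) bounds
the second moment at time t by e^{Ct}Φ_0, the initial deviations vanish by assumption, and Chebyshev
concludes. No tightness argument is needed.

The disorder enters only through color averages. Hoeffding and Borel-Cantelli give their almost sure
convergence for a countable dense family of test functions. Being equi-Lipschitz in the test
function, they converge for all continuous ones, and uniformly on compact subsets of C(Λ); such a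
set is formed by the products of J(r - ·) with the response to J * m(t), over all r and t. The
exceptional null set thus depends on neither t, δ, Ḡ nor the laws.

The limit equation is an ordinary differential equation in C(Λ)² with bounded Lipschitz
nonlinearity, which gives a solution continuous in r. Two weak solutions are compared through their
pairings with all H ∈ C(Λ): J * m at r is itself such a pairing, so an iterated integral inequality
forces all differences to vanish. -/

lemma Real.hasDerivAt_tanh' (x : ℝ) : HasDerivAt Real.tanh (1 / Real.cosh x ^ 2) x := by
  have h := (Real.hasDerivAt_sinh x).div (Real.hasDerivAt_cosh x) (Real.cosh_pos x).ne'
  have e : (Real.sinh / Real.cosh) = Real.tanh := by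
    funext y; simp [Real.tanh_eq_sinh_div_cosh]
  rw [e] at h
  have e2 : (Real.cosh x * Real.cosh x - Real.sinh x * Real.sinh x) / Real.cosh x ^ 2
      = 1 / Real.cosh x ^ 2 := by
    rw [← Real.cosh_sq_sub_sinh_sq x]
    ring
  rwa [e2] at h

lemma Real.lipschitzWith_tanh : LipschitzWith 1 Real.tanh := by
  refine lipschitzWith_of_nnnorm_deriv_le (fun x => (Real.hasDerivAt_tanh' x).differentiableAt) ?_
  intro x
  rw [(Real.hasDerivAt_tanh' x).deriv, ← NNReal.coe_le_coe, coe_nnnorm, Real.norm_eq_abs,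
    abs_of_nonneg (by positivity), NNReal.coe_one, div_le_one (by positivity)]
  nlinarith [Real.one_le_cosh x]

lemma Real.abs_tanh_sub_le (x y : ℝ) : |Real.tanh x - Real.tanh y| ≤ |x - y| := by
  simpa [Real.dist_eq] using Real.lipschitzWith_tanh.dist_le_mul x y

lemma Real.continuous_tanh' : Continuous Real.tanh := Real.lipschitzWith_tanh.continuous

/-! ### Abstract tools: a global flow, and equi-Lipschitz families of functionals -/

/-- Global existence for `v' = -v + N v` with `N` bounded and Lipschitz. -/
theorem exists_relaxation_flow {E : Type*} [NormedAddCommGroup E] [NormedSpace ℝ E]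
    [CompleteSpace E] {N : E → E} {K : NNReal} (hN : LipschitzWith K N) {M : ℝ} (hM : 0 ≤ M)
    (hb : ∀ x, ‖N x‖ ≤ M) {T : ℝ} (hT : 0 ≤ T) (v₀ : E) :
    ∃ v : ℝ → E, v 0 = v₀ ∧
      ∀ t ∈ Set.Icc 0 T, HasDerivWithinAt v (-v t + N (v t)) (Set.Icc 0 T) t := by
  -- Integrating factor: z = e^t v solves z' = e^t N(e^{-t} z). This right-hand side is bounded by
  -- e^T M, so a ball of radius e^T M T serves all of [0, T] at once, and its Lipschitz constant is
  -- still K.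
  let f : ℝ → E → E := fun t z => Real.exp t • N (Real.exp (-t) • z)
  have hf : IsPicardLindelof f (tmin := 0) (tmax := T) ⟨0, by simp [hT]⟩ v₀
      ⟨Real.exp T * M * T, by positivity⟩ 0 ⟨Real.exp T * M, by positivity⟩ K := by
    refine ⟨fun t _ => ?_, fun x _ => ?_, fun t ht x _ => ?_, ?_⟩
    · refine LipschitzWith.lipschitzOnWith (LipschitzWith.of_dist_le_mul fun x y => ?_)
      simp only [f]
      rw [dist_smul₀, Real.norm_eq_abs, Real.abs_exp]
      calc _ ≤ Real.exp t * (K * dist (Real.exp (-t) • x) (Real.exp (-t) • y)) := by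
            gcongr; exact hN.dist_le_mul _ _
        _ = Real.exp t * Real.exp (-t) * (K * dist x y) := by
            rw [dist_smul₀, Real.norm_eq_abs, Real.abs_exp]; ring
        _ = _ := by rw [← Real.exp_add]; simp
    · have := hN.continuous
      simp only [f]
      fun_prop
    · simp only [f]
      rw [norm_smul, Real.norm_eq_abs, Real.abs_exp]
      change _ ≤ Real.exp T * M
      gcongr
      · exact ht.2
      · exact hb _
    · simp only [sub_zero, sub_self, max_eq_left hT, NNReal.coe_zero]
      exact le_rfl
  obtain ⟨z, hz0, hz⟩ := hf.exists_eq_forall_mem_Icc_hasDerivWithinAt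
    (x := v₀) (by simp)
  refine ⟨fun t => Real.exp (-t) • z t, by simpa using hz0, fun t ht => ?_⟩
  have h1 : HasDerivWithinAt (fun t : ℝ => Real.exp (-t)) (-Real.exp (-t)) (Set.Icc 0 T) t := by
    simpa using ((hasDerivAt_neg t).exp).hasDerivWithinAt
  have h2 := h1.smul (hz t ht)
  have e : Real.exp (-t) • f t (z t) + -Real.exp (-t) • z t
      = -(Real.exp (-t) • z t) + N (Real.exp (-t) • z t) := by
    simp only [f]
    rw [smul_smul, ← Real.exp_add]
    simp [add_comm]
  rwa [e] at h2

/-- Equi-Lipschitz functions which tend to zero on a dense set tend to zero everywhere. -/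
theorem tendsto_zero_of_dense {E ι : Type*} [PseudoMetricSpace E] {l : Filter ι} {F : ι → E → ℝ}
    {C : ℝ} (hF : ∀ k x y, |F k x - F k y| ≤ C * dist x y) {s : Set E} (hs : Dense s)
    (h : ∀ x ∈ s, Tendsto (fun k => F k x) l (𝓝 0)) (x : E) :
    Tendsto (fun k => F k x) l (𝓝 0) := by
  rw [Metric.tendsto_nhds]
  intro ε hε
  obtain ⟨y, hy, hxy⟩ := Metric.dense_iff.1 hs x (ε / 2 / (|C| + 1)) (by positivity)
  filter_upwards [Metric.tendsto_nhds.1 (h y hxy) (ε / 2) (by positivity)] with k hk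
  rw [Real.dist_eq, sub_zero] at hk ⊢
  have h1 := hF k x y
  rw [Metric.mem_ball, dist_comm] at hy
  have h2 : C * dist x y ≤ ε / 2 := by
    calc C * dist x y ≤ (|C| + 1) * dist x y := by
          gcongr; linarith [le_abs_self C]
      _ ≤ (|C| + 1) * (ε / 2 / (|C| + 1)) := by gcongr
      _ = ε / 2 := by field_simp
  have h3 := abs_sub_abs_le_abs_sub (F k x) (F k y)
  linarith

/-- Equi-Lipschitz functions which tend to zero pointwise do so uniformly on compact sets. -/
theorem eventually_forall_abs_le_of_isCompact {E ι : Type*} [PseudoMetricSpace E] {l : Filter ι}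
    {F : ι → E → ℝ} {C : ℝ} (hF : ∀ k x y, |F k x - F k y| ≤ C * dist x y)
    (h : ∀ x, Tendsto (fun k => F k x) l (𝓝 0)) {K : Set E} (hK : IsCompact K) {ε : ℝ}
    (hε : 0 < ε) : ∀ᶠ k in l, ∀ x ∈ K, |F k x| ≤ ε := by
  obtain ⟨t, -, ht, hKt⟩ := hK.finite_cover_balls (e := ε / 2 / (|C| + 1)) (by positivity)
  have : ∀ᶠ k in l, ∀ y ∈ t, |F k y| < ε / 2 := by
    rw [eventually_all_finite ht]
    intro y _
    simpa [Real.dist_eq] using Metric.tendsto_nhds.1 (h y) (ε / 2) (by positivity)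
  filter_upwards [this] with k hk x hx
  obtain ⟨y, hy, hxy⟩ := Set.mem_iUnion₂.1 (hKt hx)
  have h1 := hF k x y
  rw [Metric.mem_ball] at hxy
  have h2 : C * dist x y ≤ ε / 2 := by
    calc C * dist x y ≤ (|C| + 1) * dist x y := by
          gcongr; linarith [le_abs_self C]
      _ ≤ (|C| + 1) * (ε / 2 / (|C| + 1)) := by gcongr
      _ = ε / 2 := by field_simp
  have h3 := abs_sub_abs_le_abs_sub (F k x) (F k y)
  linarith [hk y hy]

/-! ### The torus, its lattice points and Riemann sums -/

instance UnitAddCircle.isProbabilityMeasure_volume :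
    IsProbabilityMeasure (volume : Measure UnitAddCircle) :=
  ⟨by simp⟩

instance Torus.isProbabilityMeasure_volume (d : ℕ) :
    IsProbabilityMeasure (volume : Measure (Torus d)) := by
  change IsProbabilityMeasure (Measure.pi _)
  infer_instance

lemma Torus.integrable_of_continuous {d : ℕ} {H : Torus d → ℝ} (hH : Continuous H) :
    Integrable H :=
  hH.integrable_of_hasCompactSupport (HasCompactSupport.of_compactSpace H)

lemma Torus.abs_integral_le {d : ℕ} (H : Torus d → ℝ) {C : ℝ}
    (h : ∀ r, |H r| ≤ C) : |∫ r, H r| ≤ C := by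
  have := norm_integral_le_of_norm_le_const (μ := (volume : Measure (Torus d)))
    (f := H) (C := C) (Eventually.of_forall h)
  simpa using this

lemma TorusC1.continuous {d : ℕ} {G : Torus d → ℝ} (hG : TorusC1 G) : Continuous G := by
  have hq : IsOpenQuotientMap (fun (x : Fin d → ℝ) (j : Fin d) => (x j : UnitAddCircle)) := by
    exact IsOpenQuotientMap.piMap (fun _ => QuotientAddGroup.isOpenQuotientMap_mk)
  exact hq.isQuotientMap.continuous_iff.2 (ContDiff.continuous hG)

section Lattice

variable {d n : ℕ} [NeZero n]

lemma scaledSite_sub (x y : DiscTorus d n) :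
    scaledSite (x - y) = scaledSite x - scaledSite y := by
  funext j; simp [scaledSite]

lemma card_mul_inv_pow : (Fintype.card (DiscTorus d n) : ℝ) * ((n : ℝ)⁻¹) ^ d = 1 := by
  have : (n : ℝ) ≠ 0 := Nat.cast_ne_zero.2 (NeZero.ne n)
  rw [Fintype.card_fun, ZMod.card, Fintype.card_fin, Nat.cast_pow, ← mul_pow,
    mul_inv_cancel₀ this, one_pow]

lemma abs_inv_pow_mul_sum_le {F : DiscTorus d n → ℝ} {C : ℝ} (h : ∀ x, |F x| ≤ C) :
    |((n : ℝ)⁻¹) ^ d * ∑ x, F x| ≤ C := by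
  rw [abs_mul, abs_of_nonneg (by positivity : (0 : ℝ) ≤ ((n : ℝ)⁻¹) ^ d)]
  calc _ ≤ ((n : ℝ)⁻¹) ^ d * ∑ x : DiscTorus d n, C := by
        gcongr
        exact (Finset.abs_sum_le_sum_abs _ _).trans (Finset.sum_le_sum fun x _ => h x)
    _ = C := by
        rw [Finset.sum_const, Finset.card_univ, nsmul_eq_mul, ← mul_assoc,
          mul_comm (_ ^ d), card_mul_inv_pow, one_mul]

lemma exists_norm_sub_scaledSite_le (r : Torus d) :
    ∃ x : DiscTorus d n, ‖r - scaledSite x‖ ≤ (n : ℝ)⁻¹ := by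
  have hn : (0 : ℝ) < n := Nat.cast_pos.2 (NeZero.pos n)
  have key : ∀ u : UnitAddCircle, ∃ y : ZMod n, ‖u - ZMod.toAddCircle y‖ ≤ (n : ℝ)⁻¹ := by
    intro u
    obtain ⟨v, rfl⟩ := QuotientAddGroup.mk_surjective u
    refine ⟨((⌊v * n⌋ : ℤ) : ZMod n), ?_⟩
    rw [ZMod.toAddCircle_intCast]
    change ‖(v : UnitAddCircle) - _‖ ≤ _
    rw [← AddCircle.coe_sub]
    refine (QuotientAddGroup.norm_mk_le_norm).trans ?_
    have h1 := Int.floor_le (v * n)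
    have h2 := Int.lt_floor_add_one (v * n)
    have e : v - ⌊v * n⌋ / n = (v * n - ⌊v * n⌋) * (n : ℝ)⁻¹ := by field_simp
    rw [e, Real.norm_eq_abs, abs_mul, abs_of_nonneg (by linarith), abs_of_pos (by positivity)]
    have : 0 < (n : ℝ)⁻¹ := by positivity
    nlinarith
  choose y hy using key
  exact ⟨fun j => y (r j), (pi_norm_le_iff_of_nonneg (by positivity)).2 fun j => hy (r j)⟩

/-- Let A(r) be the Riemann sum of H translated by r. By translation invariance A has integral ∫ H.
The sum is unchanged by lattice shifts and every r is within 1/n of a lattice point, so A(r) differs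
from A(0) by at most the oscillation of H at scale 1/n. -/
lemma abs_riemannSum_sub_integral_le {H : Torus d → ℝ} (hH : Continuous H) {ε : ℝ}
    (h : ∀ r s : Torus d, ‖r - s‖ ≤ (n : ℝ)⁻¹ → |H r - H s| ≤ ε) :
    |((n : ℝ)⁻¹) ^ d * ∑ x : DiscTorus d n, H (scaledSite x) - ∫ r, H r| ≤ ε := by
  set A : Torus d → ℝ := fun r => ((n : ℝ)⁻¹) ^ d * ∑ x : DiscTorus d n, H (scaledSite x + r)
    with hA
  have hint : ∫ r, A r = ∫ r, H r := by
    simp only [hA]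
    rw [integral_const_mul, integral_finsetSum]
    · simp_rw [integral_add_left_eq_self (μ := (volume : Measure (Torus d))) H]
      rw [Finset.sum_const, Finset.card_univ, nsmul_eq_mul, ← mul_assoc,
          mul_comm (_ ^ d), card_mul_inv_pow, one_mul]
    · intro x _
      exact Torus.integrable_of_continuous (by fun_prop)
  have hosc : ∀ r, |A 0 - A r| ≤ ε := by
    intro r
    obtain ⟨y, hy⟩ := exists_norm_sub_scaledSite_le (n := n) r
    have e : A r = ((n : ℝ)⁻¹) ^ d * ∑ x : DiscTorus d n,
        H (scaledSite x + (r - scaledSite y)) := by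
      simp only [hA]
      congr 1
      rw [← Equiv.sum_comp (Equiv.subRight y)]
      simp only [Equiv.subRight_apply, scaledSite_sub]
      exact Finset.sum_congr rfl fun x _ => by congr 1; abel
    rw [e]
    simp only [hA]
    rw [← mul_sub, ← Finset.sum_sub_distrib]
    refine abs_inv_pow_mul_sum_le fun x => h _ _ ?_
    simpa [norm_sub_rev] using hy
  have hAc : Continuous A := by simp only [hA]; fun_prop
  have h0 : A 0 = ((n : ℝ)⁻¹) ^ d * ∑ x : DiscTorus d n, H (scaledSite x) := by simp [hA]
  rw [← h0, ← hint]
  have e2 : A 0 - ∫ r, A r = ∫ r, (A 0 - A r) := by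
    rw [integral_sub (integrable_const _) (Torus.integrable_of_continuous hAc)]
    simp
  rw [e2]
  exact Torus.abs_integral_le _ hosc

end Lattice

theorem tendsto_riemannSum {d : ℕ} {H : Torus d → ℝ} (hH : Continuous H) :
    Tendsto (fun k : ℕ => (((2 * k + 1 : ℕ) : ℝ)⁻¹) ^ d *
      ∑ x : DiscTorus d (2 * k + 1), H (scaledSite x)) atTop (𝓝 (∫ r, H r)) := by
  rw [Metric.tendsto_nhds]
  intro ε hε
  obtain ⟨δ, hδ, h⟩ := Metric.uniformContinuous_iff.1
    (CompactSpace.uniformContinuous_of_continuous hH) (ε / 2) (by positivity)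
  have hlim : Tendsto (fun k : ℕ => (((2 * k + 1 : ℕ) : ℝ)⁻¹)) atTop (𝓝 0) :=
    (tendsto_inv_atTop_zero.comp tendsto_natCast_atTop_atTop).comp
      (tendsto_atTop_mono (fun k => by simp only [id]; omega) tendsto_id)
  filter_upwards [hlim.eventually (gt_mem_nhds hδ)] with k hk
  rw [Real.dist_eq]
  refine (abs_riemannSum_sub_integral_le hH (ε := ε / 2) fun r s hrs => ?_).trans_lt (by linarith)
  have := h (a := r) (b := s) (by rw [dist_eq_norm]; exact hrs.trans_lt hk)
  rw [Real.dist_eq] at this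
  exact this.le

/-! ### Strong law of large numbers on the discrete tori -/

section StrongLaw

variable {Ω : Type*} [MeasurableSpace Ω] {P : Measure Ω} [IsProbabilityMeasure P] {d : ℕ}

/-- Distinct sites of the discrete torus read distinct variables of the field, so independence is
inherited. -/
lemma valMinAbs_comp_injective (d n : ℕ) :
    Function.Injective (fun (x : DiscTorus d n) (j : Fin d) => (x j).valMinAbs) := by
  intro x y h
  funext j
  exact ZMod.valMinAbs_inj.1 (congrFun h j)

lemma le_card_discTorus (hd : 0 < d) (k : ℕ) :
    (k : ℝ) ≤ Fintype.card (DiscTorus d (2 * k + 1)) := by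
  rw [Fintype.card_fun, ZMod.card, Fintype.card_fin]
  have : k ≤ (2 * k + 1) ^ d :=
    le_trans (by omega) (Nat.le_self_pow hd.ne' (2 * k + 1))
  exact_mod_cast this

/-- The summands lie in [-B, B], so Hoeffding bounds the bad event by exp(-ε²N / (2B²)) with N the
number of sites. As N ≥ k this is summable, and Borel-Cantelli applies. The weights change with k,
so this is a law for triangular arrays. -/
lemma ae_eventually_weightedSum_lt (hd : 0 < d) {ξ : (Fin d → ℤ) → Ω → ℝ}
    (hm : ∀ x, Measurable (ξ x)) (hind : ProbabilityTheory.iIndepFun ξ P)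
    (hb : ∀ x ω, |ξ x ω| ≤ 1) (h0 : ∀ x, ∫ ω, ξ x ω ∂P = 0)
    {b : ∀ k, DiscTorus d (2 * k + 1) → ℝ} {B : ℝ} (hB : 0 < B) (hbB : ∀ k x, |b k x| ≤ B)
    {ε : ℝ} (hε : 0 < ε) :
    ∀ᵐ ω ∂P, ∀ᶠ k in atTop,
      ∑ x, b k x * ξ (fun j => (x j).valMinAbs) ω
        < ε * Fintype.card (DiscTorus d (2 * k + 1)) := by
  set q : ℝ := ε ^ 2 / (2 * B ^ 2) with hq
  have hq0 : 0 < q := by positivity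
  have hbound : ∀ k, P {ω | ε * Fintype.card (DiscTorus d (2 * k + 1)) ≤
      ∑ x, b k x * ξ (fun j => (x j).valMinAbs) ω} ≤ ENNReal.ofReal (Real.exp (-q) ^ k) := by
    intro k
    have hsub : ∀ x ∈ (Finset.univ : Finset (DiscTorus d (2 * k + 1))),
        ProbabilityTheory.HasSubgaussianMGF
          (fun ω => b k x * ξ (fun j => (x j).valMinAbs) ω) ((‖B - (-B)‖₊ / 2) ^ 2) P := by
      intro x _
      refine ProbabilityTheory.hasSubgaussianMGF_of_mem_Icc_of_integral_eq_zero
        ((hm _).const_mul _).aemeasurable (Eventually.of_forall fun ω => ?_) ?_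
      · rw [Set.mem_Icc, ← abs_le, abs_mul]
        calc _ ≤ B * 1 := mul_le_mul (hbB k x) (hb _ _) (abs_nonneg _) hB.le
          _ = B := mul_one B
      · rw [integral_const_mul, h0, mul_zero]
    have hind' : ProbabilityTheory.iIndepFun
        (fun (x : DiscTorus d (2 * k + 1)) ω => b k x * ξ (fun j => (x j).valMinAbs) ω) P :=
      (hind.precomp (valMinAbs_comp_injective d (2 * k + 1))).comp
        (fun x u => b k x * u) (fun x => measurable_const_mul _)
    have h := ProbabilityTheory.HasSubgaussianMGF.measure_sum_ge_le_of_iIndepFun hind' hsub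
      (ε := ε * Fintype.card (DiscTorus d (2 * k + 1))) (by positivity)
    have hN : (0 : ℝ) < Fintype.card (DiscTorus d (2 * k + 1)) :=
      Nat.cast_pos.2 Fintype.card_pos
    rw [← ENNReal.ofReal_toReal (measure_ne_top P {ω | _})]
    refine ENNReal.ofReal_le_ofReal (h.trans ?_)
    rw [← Real.exp_nat_mul]
    refine Real.exp_le_exp.2 ?_
    have hc : ((∑ _x : DiscTorus d (2 * k + 1), (‖B - (-B)‖₊ / 2) ^ 2 : NNReal) : ℝ)
        = Fintype.card (DiscTorus d (2 * k + 1)) * B ^ 2 := by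
      have : |B + B| = B + B := abs_of_pos (by linarith)
      simp [this]
    rw [hc]
    have e : -(ε * Fintype.card (DiscTorus d (2 * k + 1))) ^ 2 /
        (2 * (Fintype.card (DiscTorus d (2 * k + 1)) * B ^ 2))
          = -(q * Fintype.card (DiscTorus d (2 * k + 1))) := by
      rw [hq]; field_simp
    rw [e]
    nlinarith [le_card_discTorus hd k]
  have hsum : ∑' k, P {ω | ε * Fintype.card (DiscTorus d (2 * k + 1)) ≤
      ∑ x, b k x * ξ (fun j => (x j).valMinAbs) ω} ≠ ⊤ := by
    refine ne_top_of_le_ne_top ?_ (ENNReal.tsum_le_tsum hbound)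
    have hs : Summable fun k : ℕ => Real.exp (-q) ^ k :=
      summable_geometric_of_lt_one (Real.exp_pos _).le (Real.exp_lt_one_iff.2 (by linarith))
    exact hs.tsum_ofReal_ne_top
  filter_upwards [ae_eventually_notMem hsum] with ω hω
  filter_upwards [hω] with k hk
  simpa using hk

/-- Strong law of large numbers along the discrete tori, with deterministic bounded weights. -/
theorem ae_tendsto_weightedAverage (hd : 0 < d) {ξ : (Fin d → ℤ) → Ω → ℝ}
    (hm : ∀ x, Measurable (ξ x)) (hind : ProbabilityTheory.iIndepFun ξ P)
    (hb : ∀ x ω, |ξ x ω| ≤ 1) (h0 : ∀ x, ∫ ω, ξ x ω ∂P = 0)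
    {b : ∀ k, DiscTorus d (2 * k + 1) → ℝ} {B : ℝ} (hbB : ∀ k x, |b k x| ≤ B) :
    ∀ᵐ ω ∂P, Tendsto (fun k : ℕ => (((2 * k + 1 : ℕ) : ℝ)⁻¹) ^ d *
      ∑ x, b k x * ξ (fun j => (x j).valMinAbs) ω) atTop (𝓝 0) := by
  have hB' : ∀ k x, |b k x| ≤ |B| + 1 := fun k x =>
    (hbB k x).trans ((le_abs_self B).trans (by linarith))
  have h1 : ∀ᵐ ω ∂P, ∀ m : ℕ, ∀ᶠ k in atTop,
      ∑ x, b k x * ξ (fun j => (x j).valMinAbs) ω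
        < (1 / ((m : ℝ) + 1)) * Fintype.card (DiscTorus d (2 * k + 1)) :=
    ae_all_iff.2 fun m => ae_eventually_weightedSum_lt hd hm hind hb h0
      (by positivity) hB' (by positivity)
  have h2 : ∀ᵐ ω ∂P, ∀ m : ℕ, ∀ᶠ k in atTop,
      ∑ x, (-b k x) * ξ (fun j => (x j).valMinAbs) ω
        < (1 / ((m : ℝ) + 1)) * Fintype.card (DiscTorus d (2 * k + 1)) :=
    ae_all_iff.2 fun m => ae_eventually_weightedSum_lt (b := fun k x => -b k x) hd hm hind hb h0
      (B := |B| + 1) (by positivity) (by simpa using hB') (by positivity)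
  filter_upwards [h1, h2] with ω hω1 hω2
  rw [Metric.tendsto_nhds]
  intro ε hε
  obtain ⟨m, hmε⟩ := exists_nat_one_div_lt hε
  filter_upwards [hω1 m, hω2 m] with k hk1 hk2
  simp only [neg_mul, Finset.sum_neg_distrib] at hk2
  rw [Real.dist_eq, sub_zero, abs_mul,
    abs_of_nonneg (by positivity : (0 : ℝ) ≤ (((2 * k + 1 : ℕ) : ℝ)⁻¹) ^ d)]
  have hg : (0 : ℝ) < (((2 * k + 1 : ℕ) : ℝ)⁻¹) ^ d := by positivity
  have hcard := card_mul_inv_pow (d := d) (n := 2 * k + 1)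
  have h3 := abs_lt.2 ⟨by linarith, hk1⟩
  calc _ < (((2 * k + 1 : ℕ) : ℝ)⁻¹) ^ d *
        ((1 / ((m : ℝ) + 1)) * Fintype.card (DiscTorus d (2 * k + 1))) := by gcongr
    _ = 1 / ((m : ℝ) + 1) := by
        rw [mul_left_comm, mul_comm (_ ^ d), hcard, mul_one]
    _ < ε := hmε

end StrongLaw

/-! ### Averages over the sites of one color -/

section Colors

variable {Ω : Type*} [MeasurableSpace Ω] {P : Measure Ω} [IsProbabilityMeasure P] {d : ℕ}

open Classical in
/-- The indicator of the event that the site `x` has color `a`. -/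
noncomputable def colorIndicator {d n : ℕ} (α : (Fin d → ℤ) → ℝ) (a : ℝ) (x : DiscTorus d n) : ℝ :=
  if inducedField n α x = a then 1 else 0

lemma abs_colorIndicator_le {n : ℕ} (α : (Fin d → ℤ) → ℝ) (a : ℝ) (x : DiscTorus d n) :
    |colorIndicator α a x| ≤ 1 := by
  unfold colorIndicator; split_ifs <;> simp

lemma ae_tendsto_colored_weightedAverage (hd : 0 < d) {α : (Fin d → ℤ) → Ω → ℝ}
    (hα : ∀ x, Measurable (α x)) (hind : ProbabilityTheory.iIndepFun α P) {a p : ℝ}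
    (hlaw : ∀ x, P.real {ω | α x ω = a} = p)
    {b : ∀ k, DiscTorus d (2 * k + 1) → ℝ} {B : ℝ} (hbB : ∀ k x, |b k x| ≤ B) :
    ∀ᵐ ω ∂P, Tendsto (fun k : ℕ => (((2 * k + 1 : ℕ) : ℝ)⁻¹) ^ d *
      ∑ x, b k x * (colorIndicator (fun y => α y ω) a x - p)) atTop (𝓝 0) := by
  classical
  have hms : ∀ x, MeasurableSet {ω | α x ω = a} := fun x => hα x (measurableSet_singleton a)
  have hf : Measurable fun u : ℝ => (if u = a then (1 : ℝ) else 0) - p :=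
    (Measurable.ite (measurableSet_singleton a) measurable_const measurable_const).sub_const p
  have hp0 : 0 ≤ p := by rw [← hlaw 0]; exact measureReal_nonneg
  have hp1 : p ≤ 1 := by rw [← hlaw 0]; exact measureReal_le_one
  exact ae_tendsto_weightedAverage hd (ξ := fun x ω => (if α x ω = a then 1 else 0) - p)
    (fun x => hf.comp (hα x)) (hind.comp (fun _ u => (if u = a then 1 else 0) - p) fun _ => hf)
    (fun x ω => by split_ifs <;> rw [abs_le] <;> constructor <;> linarith)
    (fun x => by
      have e : (fun ω => if α x ω = a then (1 : ℝ) else 0)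
          = Set.indicator {ω | α x ω = a} (fun _ => (1 : ℝ)) := by
        funext ω; simp [Set.indicator_apply]
      have hi : Integrable (fun ω => if α x ω = a then (1 : ℝ) else 0) P := by
        rw [e]; exact (integrable_const _).indicator (hms x)
      rw [integral_sub hi (integrable_const _), e, integral_indicator_const _ (hms x), hlaw]
      simp) hbB

/-- Almost surely, colored averages of continuous functions converge. -/
theorem ae_forall_tendsto_colored_average (hd : 0 < d) {α : (Fin d → ℤ) → Ω → ℝ}
    (hα : ∀ x, Measurable (α x)) (hind : ProbabilityTheory.iIndepFun α P) {a p : ℝ}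
    (hlaw : ∀ x, P.real {ω | α x ω = a} = p)
    {c : ∀ k, DiscTorus d (2 * k + 1) → ℝ} (hc : ∀ k x, |c k x| ≤ 1) {μ₀ : Torus d → ℝ}
    (hlim : ∀ H : Torus d → ℝ, Continuous H → Tendsto (fun k : ℕ =>
      (((2 * k + 1 : ℕ) : ℝ)⁻¹) ^ d * ∑ x : DiscTorus d (2 * k + 1), H (scaledSite x) * c k x)
      atTop (𝓝 (∫ r, H r * μ₀ r))) :
    ∀ᵐ ω ∂P, ∀ H : C(Torus d, ℝ), Tendsto (fun k : ℕ =>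
      (((2 * k + 1 : ℕ) : ℝ)⁻¹) ^ d * ∑ x : DiscTorus d (2 * k + 1),
        H (scaledSite x) * colorIndicator (fun y => α y ω) a x * c k x)
      atTop (𝓝 (p * ∫ r, H r * μ₀ r)) := by
  have hp0 : 0 ≤ p := by rw [← hlaw 0]; exact measureReal_nonneg
  have hp1 : p ≤ 1 := by rw [← hlaw 0]; exact measureReal_le_one
  -- Separability of C(Λ) leaves countably many null sets. The weights H(γx)c(x) must be
  -- deterministic for the strong law to apply.
  have key : ∀ᵐ ω ∂P, ∀ i : ℕ, Tendsto (fun k : ℕ => (((2 * k + 1 : ℕ) : ℝ)⁻¹) ^ d *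
      ∑ x : DiscTorus d (2 * k + 1),
        (TopologicalSpace.denseSeq C(Torus d, ℝ) i (scaledSite x) * c k x) *
          (colorIndicator (fun y => α y ω) a x - p)) atTop (𝓝 0) := by
    refine ae_all_iff.2 fun i => ae_tendsto_colored_weightedAverage hd hα hind hlaw
      (B := ‖TopologicalSpace.denseSeq C(Torus d, ℝ) i‖ * 1) fun k x => ?_
    rw [abs_mul]
    exact mul_le_mul (ContinuousMap.norm_coe_le_norm (TopologicalSpace.denseSeq C(Torus d, ℝ) i) _) (hc k x) (abs_nonneg _) (norm_nonneg _)
  filter_upwards [key] with ω hω H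
  have h0 := tendsto_zero_of_dense (l := atTop) (C := 1)
    (F := fun (k : ℕ) (H : C(Torus d, ℝ)) => (((2 * k + 1 : ℕ) : ℝ)⁻¹) ^ d *
      ∑ x : DiscTorus d (2 * k + 1), (H (scaledSite x) * c k x) *
          (colorIndicator (fun y => α y ω) a x - p))
    (fun k H H' => by
      rw [← mul_sub, ← Finset.sum_sub_distrib]
      refine abs_inv_pow_mul_sum_le fun x => ?_
      rw [← sub_mul, ← sub_mul, abs_mul, abs_mul]
      have h1 : |H (scaledSite x) - H' (scaledSite x)| ≤ dist H H' := by
        rw [← Real.dist_eq]; exact ContinuousMap.dist_apply_le_dist _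
      have h2 : |colorIndicator (fun y => α y ω) a x - p| ≤ 1 := by
        unfold colorIndicator
        split_ifs <;> rw [abs_le] <;> constructor <;> linarith
      calc _ ≤ dist H H' * 1 * 1 := by
            gcongr
            exact hc k x
        _ = _ := by ring)
    (TopologicalSpace.denseRange_denseSeq C(Torus d, ℝ))
    (by rintro _ ⟨i, rfl⟩; exact hω i) H
  -- Split the indicator as (indicator - p) + p: the fluctuation vanishes and the mean part
  -- converges by `hlim`.
  have h1 := h0.add ((hlim H H.continuous).const_mul p)
  rw [zero_add] at h1
  refine h1.congr fun k => ?_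
  rw [mul_left_comm p, ← mul_add, Finset.mul_sum, ← Finset.sum_add_distrib]
  congr 1
  exact Finset.sum_congr rfl fun x _ => by ring

end Colors

/-! ### The limit equation in C(Λ)² and existence of a weak solution -/

section LimitEquation

variable {d : ℕ}

/-- The section `r' ↦ J (r - r')`, as a continuous function of `r`. -/
noncomputable def kernelSection (J : C(Torus d, ℝ)) : C(Torus d, C(Torus d, ℝ)) :=
  ContinuousMap.curry ⟨fun q : Torus d × Torus d => J (q.1 - q.2), by fun_prop⟩

@[simp] lemma kernelSection_apply (J : C(Torus d, ℝ)) (r r' : Torus d) :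
    kernelSection J r r' = J (r - r') := rfl

lemma norm_kernelSection_le (J : C(Torus d, ℝ)) (r : Torus d) : ‖kernelSection J r‖ ≤ ‖J‖ :=
  (ContinuousMap.norm_le _ (norm_nonneg _)).2 fun r' => J.norm_coe_le_norm (r - r')

lemma integrable_mul_of_integrable (H : C(Torus d, ℝ)) {u : Torus d → ℝ} (hu : Integrable u) :
    Integrable fun r => H r * u r :=
  hu.bdd_mul H.continuous.aestronglyMeasurable (c := ‖H‖)
    (Eventually.of_forall fun r => H.norm_coe_le_norm r)

lemma abs_integral_mul_le (H : C(Torus d, ℝ)) {u : Torus d → ℝ} {C : ℝ}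
    (hu : ∀ᵐ r, |u r| ≤ C) : |∫ r, H r * u r| ≤ ‖H‖ * C := by
  have := norm_integral_le_of_norm_le_const (μ := (volume : Measure (Torus d)))
    (f := fun r => H r * u r) (C := ‖H‖ * C) (by
      filter_upwards [hu] with r hr
      rw [norm_mul]
      exact mul_le_mul (H.norm_coe_le_norm r) hr (norm_nonneg _) (norm_nonneg _))
  simpa using this

lemma continuous_torusConv (J : C(Torus d, ℝ)) {u : Torus d → ℝ} (hu : Integrable u) :
    Continuous (torusConv J u) := by
  refine continuous_of_dominated (bound := fun r' => ‖J‖ * ‖u r'‖) (fun r => ?_) (fun r => ?_)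
    (hu.norm.const_mul _) (Eventually.of_forall fun r' => by fun_prop)
  · exact (integrable_mul_of_integrable (kernelSection J r) hu).aestronglyMeasurable
  · refine Eventually.of_forall fun r' => ?_
    rw [norm_mul]
    gcongr
    exact J.norm_coe_le_norm _

/-- The field `J * (v₁ + v₂)` of a pair of continuous profiles. -/
noncomputable def meanField (J : C(Torus d, ℝ)) (v : Fin 2 → C(Torus d, ℝ)) : C(Torus d, ℝ) :=
  ⟨torusConv J (fun r' => v 0 r' + v 1 r'), continuous_torusConv J
    (Torus.integrable_of_continuous (by fun_prop))⟩

lemma meanField_apply (J : C(Torus d, ℝ)) (v : Fin 2 → C(Torus d, ℝ)) (r : Torus d) :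
    meanField J v r = torusConv J (fun r' => v 0 r' + v 1 r') r := rfl

/-- Exhibits the field at r as a pairing of the profiles with a continuous test function; this is
what closes the estimates on the field. -/
lemma meanField_eq_sum (J : C(Torus d, ℝ)) (v : Fin 2 → C(Torus d, ℝ)) (r : Torus d) :
    meanField J v r = ∑ i, ∫ r', kernelSection J r r' * v i r' := by
  rw [Fin.sum_univ_two, ← integral_add, meanField_apply, torusConv]
  · simp [mul_add]
  · exact Torus.integrable_of_continuous (by fun_prop)
  · exact Torus.integrable_of_continuous (by fun_prop)

lemma dist_meanField_le (J : C(Torus d, ℝ)) (v w : Fin 2 → C(Torus d, ℝ)) :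
    dist (meanField J v) (meanField J w) ≤ 2 * ‖J‖ * dist v w := by
  refine (ContinuousMap.dist_le (by positivity)).2 fun r => ?_
  rw [meanField_eq_sum, meanField_eq_sum, Real.dist_eq, ← Finset.sum_sub_distrib]
  have h : ∀ i, |(∫ r', kernelSection J r r' * v i r') - ∫ r', kernelSection J r r' * w i r'|
      ≤ ‖J‖ * dist v w := by
    intro i
    rw [← integral_sub (Torus.integrable_of_continuous (by fun_prop))
      (Torus.integrable_of_continuous (by fun_prop))]
    simp_rw [← mul_sub]
    refine (abs_integral_mul_le _ (C := dist v w) (Eventually.of_forall fun r' => ?_)).trans ?_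
    · rw [← Real.dist_eq]
      exact (ContinuousMap.dist_apply_le_dist r').trans (dist_le_pi_dist v w i)
    · gcongr
      exact norm_kernelSection_le J r
  rw [Fin.sum_univ_two]
  refine (abs_add_le _ _).trans ?_
  linarith [h 0, h 1]

/-- The mean response `tanh (β (f + a θ))` to a field `f`. -/
noncomputable def response (β θ a : ℝ) (f : C(Torus d, ℝ)) : C(Torus d, ℝ) :=
  ⟨fun r => Real.tanh (β * (f r + a * θ)),
    Real.continuous_tanh'.comp (by fun_prop)⟩

lemma response_apply (β θ a : ℝ) (f : C(Torus d, ℝ)) (r : Torus d) :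
    response β θ a f r = Real.tanh (β * (f r + a * θ)) := rfl

lemma abs_tanh_mul_sub_le (β h x y : ℝ) :
    |Real.tanh (β * (x + h)) - Real.tanh (β * (y + h))| ≤ |β| * |x - y| := by
  refine (Real.abs_tanh_sub_le _ _).trans ?_
  rw [← abs_mul]
  exact le_of_eq (by congr 1; ring)

lemma dist_response_le (β θ a : ℝ) (f g : C(Torus d, ℝ)) :
    dist (response β θ a f) (response β θ a g) ≤ |β| * dist f g := by
  refine (ContinuousMap.dist_le (by positivity)).2 fun r => ?_
  rw [response_apply, response_apply, Real.dist_eq]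
  refine (abs_tanh_mul_sub_le _ _ _ _).trans ?_
  gcongr
  rw [← Real.dist_eq]
  exact ContinuousMap.dist_apply_le_dist r

lemma continuous_response (β θ a : ℝ) : Continuous (response (d := d) β θ a) :=
  (LipschitzWith.of_dist_le_mul (K := ⟨|β|, abs_nonneg β⟩) (dist_response_le β θ a)).continuous

lemma norm_response_le (β θ a : ℝ) (f : C(Torus d, ℝ)) : ‖response β θ a f‖ ≤ 1 :=
  (ContinuousMap.norm_le _ zero_le_one).2 fun _ => (Real.abs_tanh_lt_one _).le

lemma continuous_meanField (J : C(Torus d, ℝ)) : Continuous (meanField J) :=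
  (LipschitzWith.of_dist_le_mul (K := ⟨2 * ‖J‖, by positivity⟩) (dist_meanField_le J)).continuous

/-- The limit equation as an ordinary differential equation in `C(Λ)²`. -/
theorem exists_limit_flow (J : C(Torus d, ℝ)) (β θ : ℝ) (a p : Fin 2 → ℝ) {T : ℝ} (hT : 0 ≤ T)
    (v₀ : Fin 2 → C(Torus d, ℝ)) :
    ∃ v : ℝ → Fin 2 → C(Torus d, ℝ), v 0 = v₀ ∧ ∀ t ∈ Set.Icc 0 T,
      HasDerivWithinAt v (-v t + fun i => p i • response β θ (a i) (meanField J (v t)))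
        (Set.Icc 0 T) t := by
  have hp : ∀ i, |p i| ≤ |p 0| + |p 1| := by
    intro i
    fin_cases i
    · simp
    · simp
  refine exists_relaxation_flow
    (N := fun w i => p i • response β θ (a i) (meanField J w))
    (K := ((|p 0| + |p 1|) * (|β| * (2 * ‖J‖))).toNNReal)
    (LipschitzWith.of_dist_le_mul fun v w => ?_) (M := |p 0| + |p 1|) (by positivity)
    (fun v => ?_) hT v₀
  · rw [Real.coe_toNNReal _ (by positivity)]
    refine (dist_pi_le_iff (by positivity)).2 fun i => ?_
    rw [dist_eq_norm, ← smul_sub, norm_smul, ← dist_eq_norm, Real.norm_eq_abs]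
    calc _ ≤ (|p 0| + |p 1|) * (|β| * (2 * ‖J‖ * dist v w)) := by
          gcongr
          · exact hp i
          · refine (dist_response_le _ _ _ _ _).trans ?_
            gcongr
            exact dist_meanField_le _ _ _
      _ = _ := by ring
  · refine (pi_norm_le_iff_of_nonneg (by positivity)).2 fun i => ?_
    rw [norm_smul, Real.norm_eq_abs]
    calc _ ≤ (|p 0| + |p 1|) * 1 := by
          gcongr
          · exact hp i
          · exact norm_response_le _ _ _ _
      _ = _ := mul_one _

section Fubini

variable {A : ℝ → Torus d → ℝ} {T : ℝ}

lemma integrable_prod_of_continuousOn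
    (hA : ContinuousOn (Function.uncurry A) (Set.Icc 0 T ×ˢ Set.univ)) {t : ℝ}
    (ht : t ∈ Set.Icc 0 T) :
    Integrable (Function.uncurry A) ((volume.restrict (Set.Ioc 0 t)).prod volume) := by
  have h1 : IntegrableOn (Function.uncurry A) (Set.Icc 0 T ×ˢ Set.univ)
      ((volume : Measure ℝ).prod (volume : Measure (Torus d))) :=
    hA.integrableOn_compact (isCompact_Icc.prod isCompact_univ)
  have h2 := h1.mono_set (Set.prod_mono (Set.Ioc_subset_Icc_self.trans
    (Set.Icc_subset_Icc_right ht.2)) (subset_refl Set.univ) : Set.Ioc 0 t ×ˢ Set.univ ⊆ _)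
  rwa [IntegrableOn, ← Measure.prod_restrict, Measure.restrict_univ] at h2

lemma integral_intervalIntegral_comm
    (hA : ContinuousOn (Function.uncurry A) (Set.Icc 0 T ×ˢ Set.univ)) {t : ℝ}
    (ht : t ∈ Set.Icc 0 T) :
    ∫ r, ∫ s in (0 : ℝ)..t, A s r = ∫ s in (0 : ℝ)..t, ∫ r, A s r := by
  simp_rw [intervalIntegral.integral_of_le ht.1]
  exact (integral_integral_swap (integrable_prod_of_continuousOn hA ht)).symm

lemma continuousOn_section
    (hA : ContinuousOn (Function.uncurry A) (Set.Icc 0 T ×ˢ Set.univ)) (r : Torus d) :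
    ContinuousOn (fun s => A s r) (Set.Icc 0 T) :=
  hA.comp (f := fun s => (s, r)) (by fun_prop) fun s hs => ⟨hs, trivial⟩

lemma continuous_slice
    (hA : ContinuousOn (Function.uncurry A) (Set.Icc 0 T ×ˢ Set.univ)) {s : ℝ}
    (hs : s ∈ Set.Icc 0 T) : Continuous (A s) := by
  rw [← continuousOn_univ]
  exact hA.comp (f := fun r => (s, r)) (by fun_prop) fun r _ => ⟨hs, trivial⟩

lemma intervalIntegrable_section
    (hA : ContinuousOn (Function.uncurry A) (Set.Icc 0 T ×ˢ Set.univ)) {t : ℝ}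
    (ht : t ∈ Set.Icc 0 T) (r : Torus d) :
    IntervalIntegrable (fun s => A s r) volume 0 t :=
  ((continuousOn_section hA r).mono (by
    rw [Set.uIcc_of_le ht.1]; exact Set.Icc_subset_Icc_right ht.2)).intervalIntegrable

end Fubini

/-- The solution of the differential equation in `C(Λ)²` is a weak solution. -/
theorem isWeakSolution_of_flow (J : C(Torus d, ℝ)) (β θ : ℝ) (a p : Fin 2 → ℝ) {T : ℝ}
    {m₀ : Torus d → ℝ} {v : ℝ → Fin 2 → C(Torus d, ℝ)}
    (hv0 : ∀ i r, v 0 i r = p i * m₀ r)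
    (hv : ∀ t ∈ Set.Icc 0 T,
      HasDerivWithinAt v (-v t + fun i => p i • response β θ (a i) (meanField J (v t)))
        (Set.Icc 0 T) t) :
    IsWeakSolution T β J θ a p m₀ (fun i t => v t i) := by
  have hvc : ContinuousOn v (Set.Icc 0 T) := fun t ht => (hv t ht).continuousWithinAt
  have hvi : ∀ i, ContinuousOn (fun t => v t i) (Set.Icc 0 T) := fun i =>
    (continuous_apply i).comp_continuousOn hvc
  have hjoint : ∀ {w : ℝ → C(Torus d, ℝ)}, ContinuousOn w (Set.Icc 0 T) →
      ContinuousOn (fun q : ℝ × Torus d => w q.1 q.2) (Set.Icc 0 T ×ˢ Set.univ) := by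
    intro w hw
    exact (continuous_eval (F := C(Torus d, ℝ))).comp_continuousOn
      ((hw.comp continuousOn_fst fun q hq => hq.1).prodMk continuousOn_snd)
  refine ⟨fun i t _ => (v t i).continuous.aestronglyMeasurable, ?_, ?_, ?_⟩
  · obtain ⟨C, hC⟩ := isCompact_Icc.exists_bound_of_continuousOn hvc
    exact ⟨C, fun i t ht => Eventually.of_forall fun r =>
      ((v t i).norm_coe_le_norm r).trans ((norm_le_pi_norm (v t) i).trans (hC t ht))⟩
  · intro i H hH
    have hlin : Continuous fun u : C(Torus d, ℝ) => ∫ r, H r * u r := by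
      refine (LipschitzWith.of_dist_le_mul (K := ⟨‖(⟨H, hH⟩ : C(Torus d, ℝ))‖, norm_nonneg _⟩)
        fun u w => ?_).continuous
      rw [Real.dist_eq, ← integral_sub]
      · simp_rw [← mul_sub]
        exact abs_integral_mul_le (⟨H, hH⟩ : C(Torus d, ℝ)) (Eventually.of_forall fun r => by
          rw [← Real.dist_eq]; exact ContinuousMap.dist_apply_le_dist r)
      · exact Torus.integrable_of_continuous (by fun_prop)
      · exact Torus.integrable_of_continuous (by fun_prop)
    exact hlin.comp_continuousOn (hvi i)
  · intro i G G' hG hG' hGG' t ht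
    have hR : ContinuousOn (fun s => response β θ (a i) (meanField J (v s))) (Set.Icc 0 T) :=
      ((continuous_response β θ (a i)).comp (continuous_meanField J)).comp_continuousOn hvc
    set A : ℝ → Torus d → ℝ := fun s r => G' s r * v s i r with hAdef
    set B : ℝ → Torus d → ℝ := fun s r => G s r *
      (-v s i r + p i * response β θ (a i) (meanField J (v s)) r) with hBdef
    have hA : ContinuousOn (Function.uncurry A) (Set.Icc 0 T ×ˢ Set.univ) :=
      hG'.mul (hjoint (hvi i))
    have hB : ContinuousOn (Function.uncurry B) (Set.Icc 0 T ×ˢ Set.univ) :=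
      hG.mul ((hjoint (hvi i)).neg.add (continuousOn_const.mul (hjoint hR)))
    -- For each fixed r this is the fundamental theorem of calculus for s ↦ G(s, r) v_i(s, r);
    -- integrating in r and exchanging integrals gives the weak equation.
    have hpt : ∀ r, (G t r * v t i r) - G 0 r * (p i * m₀ r) =
        (∫ s in (0 : ℝ)..t, A s r) + ∫ s in (0 : ℝ)..t, B s r := by
      intro r
      rw [← intervalIntegral.integral_add (intervalIntegrable_section hA ht r)
        (intervalIntegrable_section hB ht r), ← hv0]
      have hder : ∀ s ∈ Set.Icc 0 T, HasDerivWithinAt (fun s => G s r * v s i r)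
          (A s r + B s r) (Set.Icc 0 T) s := by
        intro s hs
        have h1 : HasDerivWithinAt (fun s => v s i)
            (-v s i + p i • response β θ (a i) (meanField J (v s))) (Set.Icc 0 T) s :=
          (hasDerivWithinAt_pi.1 (hv s hs)) i
        have h2 : HasDerivWithinAt (fun s => v s i r)
            (-v s i r + p i * response β θ (a i) (meanField J (v s)) r) (Set.Icc 0 T) s := by
          have := (ContinuousMap.evalCLM ℝ r).hasFDerivAt.comp_hasDerivWithinAt s h1
          exact this
        exact (hGG' r s hs).mul h2
      refine (intervalIntegral.integral_eq_sub_of_hasDerivAt_of_le ht.1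
        (fun s hs => ((hder s ⟨hs.1, hs.2.trans ht.2⟩).continuousWithinAt).mono
          (Set.Icc_subset_Icc_right ht.2))
        (fun s hs => (hder s ⟨hs.1.le, hs.2.le.trans ht.2⟩).hasDerivAt
          (Icc_mem_nhds hs.1 (hs.2.trans_le ht.2)))
        ((intervalIntegrable_section hA ht r).add (intervalIntegrable_section hB ht r))).symm
    have h0T : (0 : ℝ) ∈ Set.Icc 0 T := ⟨le_rfl, ht.1.trans ht.2⟩
    have hi1 : Integrable fun r => G t r * v t i r :=
      Torus.integrable_of_continuous ((continuous_slice hG ht).mul (v t i).continuous)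
    have hi2 : Integrable fun r => G 0 r * (p i * m₀ r) := by
      simp_rw [← hv0]
      exact Torus.integrable_of_continuous ((continuous_slice hG h0T).mul (v 0 i).continuous)
    have hi3 : Integrable fun r => ∫ s in (0 : ℝ)..t, A s r := by
      simp_rw [intervalIntegral.integral_of_le ht.1]
      exact (integrable_prod_of_continuousOn hA ht).integral_prod_right
    have hi4 : Integrable fun r => ∫ s in (0 : ℝ)..t, B s r := by
      simp_rw [intervalIntegral.integral_of_le ht.1]
      exact (integrable_prod_of_continuousOn hB ht).integral_prod_right
    change (∫ r, G t r * v t i r) - (∫ r, G 0 r * (p i * m₀ r))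
      - (∫ s in (0 : ℝ)..t, ∫ r, A s r) = ∫ s in (0 : ℝ)..t, ∫ r, B s r
    rw [← integral_sub hi1 hi2, ← integral_intervalIntegral_comm hA ht,
      ← integral_intervalIntegral_comm hB ht, sub_eq_iff_eq_add']
    rw [← integral_add hi3 hi4]
    exact integral_congr_ae (Eventually.of_forall hpt)

end LimitEquation

/-! ### Uniqueness of weak solutions -/

section Uniqueness

variable {d : ℕ}

/-- A bounded function orthogonal to all continuous functions vanishes. -/
theorem ae_eq_zero_of_forall_integral_continuous_mul {u : Torus d → ℝ}
    (hm : AEStronglyMeasurable u volume) {C : ℝ} (hC : ∀ᵐ r, |u r| ≤ C)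
    (h : ∀ H : C(Torus d, ℝ), ∫ r, H r * u r = 0) : u =ᵐ[volume] 0 := by
  have hu : Integrable u := Integrable.of_bound hm C hC
  have hu2 : Integrable fun r => u r * u r := hu.bdd_mul hm hC
  have hC0 : 0 ≤ C := by
    obtain ⟨r, hr⟩ := hC.exists
    exact (abs_nonneg _).trans hr
  -- For g continuous and ε-close to u in L¹, orthogonality gives ∫ u² = ∫ (u - g)u ≤ Cε.
  have key : ∀ ε > 0, ∫ r, u r * u r ≤ C * ε := by
    intro ε hε
    obtain ⟨g, hg, hgi⟩ := hu.exists_boundedContinuous_integral_sub_le hε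
    have hgu : Integrable fun r => g r * u r :=
      hu.bdd_mul g.continuous.aestronglyMeasurable (c := ‖g‖)
        (Eventually.of_forall fun r => g.norm_coe_le_norm r)
    have e : ∫ r, u r * u r = ∫ r, (u r - g r) * u r := by
      simp_rw [sub_mul]
      rw [integral_sub hu2 hgu]
      have := h g.toContinuousMap
      simp only [BoundedContinuousFunction.coe_toContinuousMap] at this
      rw [this, sub_zero]
    rw [e]
    calc ∫ r, (u r - g r) * u r ≤ ∫ r, C * ‖u r - g r‖ := by
          refine integral_mono_ae ?_ ((hu.sub hgi).norm.const_mul C) ?_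
          · simp_rw [sub_mul]; exact hu2.sub hgu
          · filter_upwards [hC] with r hr
            calc _ ≤ |(u r - g r) * u r| := le_abs_self _
              _ = |u r| * |u r - g r| := by rw [abs_mul, mul_comm]
              _ ≤ C * ‖u r - g r‖ := by gcongr; exact le_rfl
      _ ≤ C * ε := by rw [integral_const_mul]; gcongr
  have h0 : ∫ r, u r * u r = 0 := by
    refine le_antisymm (le_of_forall_pos_le_add fun ε hε => ?_)
      (integral_nonneg fun r => mul_self_nonneg _)
    refine (key (ε / (C + 1)) (by positivity)).trans ?_
    rw [zero_add, mul_div_assoc', div_le_iff₀ (by positivity)]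
    nlinarith
  have h1 := (integral_eq_zero_iff_of_nonneg (fun r => mul_self_nonneg (u r)) hu2).1 h0
  filter_upwards [h1] with r hr
  simpa using hr

variable {T β θ : ℝ} {J : C(Torus d, ℝ)} {a p : Fin 2 → ℝ} {m₀ : Torus d → ℝ}
  {m m' : Fin 2 → ℝ → Torus d → ℝ}

namespace IsWeakSolution

lemma integrable (hm : IsWeakSolution T β J θ a p m₀ m) (i : Fin 2) {t : ℝ}
    (ht : t ∈ Set.Icc 0 T) : Integrable (m i t) := by
  obtain ⟨C, hC⟩ := hm.bounded
  exact Integrable.of_bound (hm.aestronglyMeasurable i t ht) C (hC i t ht)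

lemma field_eq_sum (hm : IsWeakSolution T β J θ a p m₀ m) {t : ℝ} (ht : t ∈ Set.Icc 0 T)
    (r : Torus d) : torusConv J (fun r' => m 0 t r' + m 1 t r') r =
      ∑ i, ∫ r', kernelSection J r r' * m i t r' := by
  rw [Fin.sum_univ_two, ← integral_add]
  · simp [torusConv, mul_add]
  · exact integrable_mul_of_integrable _ (hm.integrable 0 ht)
  · exact integrable_mul_of_integrable _ (hm.integrable 1 ht)

lemma continuous_response_field (hm : IsWeakSolution T β J θ a p m₀ m) (i : Fin 2) {t : ℝ}
    (ht : t ∈ Set.Icc 0 T) : Continuous fun r => Real.tanh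
      (β * (torusConv J (fun r' => m 0 t r' + m 1 t r') r + a i * θ)) := by
  have := continuous_torusConv J ((hm.integrable 0 ht).add (hm.integrable 1 ht))
  exact Real.continuous_tanh'.comp ((this.add continuous_const).const_mul β)

lemma integrable_mul_response (hm : IsWeakSolution T β J θ a p m₀ m) (i : Fin 2) {t : ℝ}
    (ht : t ∈ Set.Icc 0 T) (H : C(Torus d, ℝ)) : Integrable fun r => H r * Real.tanh
      (β * (torusConv J (fun r' => m 0 t r' + m 1 t r') r + a i * θ)) :=
  Torus.integrable_of_continuous (H.continuous.mul (hm.continuous_response_field i ht))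

/-- At fixed r the field is a pairing with a continuous function, hence continuous in time by weak-*
continuity; as |tanh| ≤ 1, dominated convergence carries this through the r-integral. -/
lemma continuousOn_integral_response (hm : IsWeakSolution T β J θ a p m₀ m) (i : Fin 2)
    (H : C(Torus d, ℝ)) : ContinuousOn (fun t => ∫ r, H r * Real.tanh
      (β * (torusConv J (fun r' => m 0 t r' + m 1 t r') r + a i * θ))) (Set.Icc 0 T) := by
  refine continuousOn_of_dominated (bound := fun _ => ‖H‖)
    (fun t ht => (H.continuous.mul (hm.continuous_response_field i ht)).aestronglyMeasurable)
    (fun t ht => Eventually.of_forall fun r => ?_) (integrable_const _)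
    (Eventually.of_forall fun r => ?_)
  · rw [norm_mul]
    calc _ ≤ ‖H‖ * 1 := mul_le_mul (H.norm_coe_le_norm r) (Real.abs_tanh_lt_one _).le
          (abs_nonneg _) (norm_nonneg _)
      _ = _ := mul_one _
  · refine continuousOn_const.mul (Real.continuous_tanh'.comp_continuousOn ?_)
    refine continuousOn_const.mul (ContinuousOn.add ?_ continuousOn_const)
    refine ContinuousOn.congr (f := fun t => ∑ i, ∫ r', kernelSection J r r' * m i t r') ?_
      fun t ht => hm.field_eq_sum ht r
    exact continuousOn_finsetSum _ fun j _ =>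
      hm.weakStarContinuous j _ (kernelSection J r).continuous

/-- The weak equation tested against a time-independent function. -/
lemma integral_eq (hm : IsWeakSolution T β J θ a p m₀ m) (i : Fin 2) (H : C(Torus d, ℝ)) {t : ℝ}
    (ht : t ∈ Set.Icc 0 T) : ∫ r, H r * m i t r = (∫ r, H r * (p i * m₀ r)) +
      ∫ s in (0 : ℝ)..t, (-(∫ r, H r * m i s r) + p i * ∫ r, H r * Real.tanh
      (β * (torusConv J (fun r' => m 0 s r' + m 1 s r') r + a i * θ))) := by
  have h := hm.weakEquation i (fun _ => H) (fun _ _ => 0)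
    (H.continuous.comp continuous_snd).continuousOn continuousOn_const
    (fun r s _ => hasDerivWithinAt_const _ _ _) t ht
  simp only [zero_mul, integral_zero, intervalIntegral.integral_zero, sub_zero] at h
  rw [sub_eq_iff_eq_add'] at h
  rw [h]
  congr 1
  refine intervalIntegral.integral_congr fun s hs => ?_
  rw [Set.uIcc_of_le ht.1] at hs
  have hs' : s ∈ Set.Icc 0 T := ⟨hs.1, hs.2.trans ht.2⟩
  rw [← integral_neg, ← integral_const_mul, ← integral_add]
  · exact integral_congr_ae (Eventually.of_forall fun r => by simp only; ring)
  · exact (integrable_mul_of_integrable H (hm.integrable i hs')).neg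
  · exact (hm.integrable_mul_response i hs' H).const_mul _

lemma intervalIntegrable_drift (hm : IsWeakSolution T β J θ a p m₀ m) (i : Fin 2)
    (H : C(Torus d, ℝ)) {t : ℝ} (ht : t ∈ Set.Icc 0 T) :
    IntervalIntegrable (fun s => -(∫ r, H r * m i s r) + p i * ∫ r, H r * Real.tanh
      (β * (torusConv J (fun r' => m 0 s r' + m 1 s r') r + a i * θ))) volume 0 t := by
  refine ContinuousOn.intervalIntegrable ?_
  rw [Set.uIcc_of_le ht.1]
  exact ((hm.weakStarContinuous i H H.continuous).neg.add
    (continuousOn_const.mul (hm.continuousOn_integral_response i H))).mono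
      (Set.Icc_subset_Icc_right ht.2)

/-- Picard iteration of the integral inequality, without forming a supremum over H. The induction
runs over all H and both colors at once, since the step for H uses the bound at the sections J(r -
·). In the rate, 1 comes from the term -m and the rest from the Lipschitz constant of the response.
-/
lemma abs_integral_sub_le (hm : IsWeakSolution T β J θ a p m₀ m)
    (hm' : IsWeakSolution T β J θ a p m₀ m') : ∃ M, 0 ≤ M ∧ ∀ n : ℕ, ∀ i, ∀ H : C(Torus d, ℝ),
      ∀ t ∈ Set.Icc 0 T, |(∫ r, H r * m' i t r) - ∫ r, H r * m i t r| ≤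
        M * ‖H‖ * (((1 + (|p 0| + |p 1|) * (|β| * (2 * ‖J‖))) * t) ^ n / n.factorial) := by
  obtain ⟨C, hC⟩ := hm.bounded
  obtain ⟨C', hC'⟩ := hm'.bounded
  set K : ℝ := 1 + (|p 0| + |p 1|) * (|β| * (2 * ‖J‖)) with hK
  have hp : ∀ i, |p i| ≤ |p 0| + |p 1| := by
    intro i
    fin_cases i
    · simp
    · simp
  refine ⟨|C| + |C'|, by positivity, fun n => ?_⟩
  induction n with
  | zero =>
    intro i H t ht
    have h1 := abs_integral_mul_le H (hC i t ht)
    have h2 := abs_integral_mul_le H (hC' i t ht)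
    have h3 := abs_sub (∫ r, H r * m' i t r) (∫ r, H r * m i t r)
    simp only [pow_zero, Nat.factorial_zero, Nat.cast_one, div_one, mul_one]
    nlinarith [norm_nonneg H, le_abs_self C, le_abs_self C']
  | succ n ih =>
    intro i H t ht
    set M : ℝ := |C| + |C'|
    have hM : 0 ≤ M := by positivity
    have e : (∫ r, H r * m' i t r) - ∫ r, H r * m i t r =
        ∫ s in (0 : ℝ)..t, (-((∫ r, H r * m' i s r) - ∫ r, H r * m i s r) +
          p i * ((∫ r, H r * Real.tanh
              (β * (torusConv J (fun r' => m' 0 s r' + m' 1 s r') r + a i * θ))) -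
            ∫ r, H r * Real.tanh
              (β * (torusConv J (fun r' => m 0 s r' + m 1 s r') r + a i * θ)))) := by
      rw [hm.integral_eq i H ht, hm'.integral_eq i H ht, add_sub_add_left_eq_sub,
        ← intervalIntegral.integral_sub (hm'.intervalIntegrable_drift i H ht)
          (hm.intervalIntegrable_drift i H ht)]
      refine intervalIntegral.integral_congr fun s _ => ?_
      ring
    rw [e, ← Real.norm_eq_abs]
    -- One time integration raises the power and the factorial by one.
    have hint : ∫ s in (0 : ℝ)..t, K * (M * ‖H‖ * ((K * s) ^ n / n.factorial)) =
        M * ‖H‖ * ((K * t) ^ (n + 1) / (n + 1).factorial) := by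
      have e1 : (fun s : ℝ => K * (M * ‖H‖ * ((K * s) ^ n / n.factorial))) =
          fun s => (K * (M * ‖H‖) * K ^ n / n.factorial) * s ^ n := by
        funext s; rw [mul_pow]; ring
      rw [e1, intervalIntegral.integral_const_mul, integral_pow, Nat.factorial_succ]
      push_cast
      rw [zero_pow (Nat.succ_ne_zero n), mul_pow]
      have : (n.factorial : ℝ) ≠ 0 := by positivity
      field_simp
      ring
    rw [← hint]
    refine intervalIntegral.norm_integral_le_of_norm_le ht.1
      (Eventually.of_forall fun s hs => ?_) (Continuous.intervalIntegrable (by fun_prop) _ _)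
    have hs' : s ∈ Set.Icc 0 T := ⟨hs.1.le, hs.2.trans ht.2⟩
    set R : ℝ := (K * s) ^ n / n.factorial
    have hfield : ∀ r, |torusConv J (fun r' => m' 0 s r' + m' 1 s r') r -
        torusConv J (fun r' => m 0 s r' + m 1 s r') r| ≤ 2 * (M * ‖J‖ * R) := by
      have hR : 0 ≤ R := by
        have := hs'.1
        positivity
      intro r
      rw [hm.field_eq_sum hs', hm'.field_eq_sum hs', Fin.sum_univ_two, Fin.sum_univ_two,
        add_sub_add_comm]
      have hj : ∀ j, |(∫ r', kernelSection J r r' * m' j s r') -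
          ∫ r', kernelSection J r r' * m j s r'| ≤ M * ‖J‖ * R := fun j =>
        (ih j (kernelSection J r) s hs').trans (by gcongr; exact norm_kernelSection_le J r)
      exact (abs_add_le _ _).trans (by linarith [hj 0, hj 1])
    have hresp : |(∫ r, H r * Real.tanh
              (β * (torusConv J (fun r' => m' 0 s r' + m' 1 s r') r + a i * θ))) -
            ∫ r, H r * Real.tanh
              (β * (torusConv J (fun r' => m 0 s r' + m 1 s r') r + a i * θ))| ≤
        ‖H‖ * (|β| * (2 * (M * ‖J‖ * R))) := by
      rw [← integral_sub (hm'.integrable_mul_response i hs' H)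
        (hm.integrable_mul_response i hs' H)]
      simp_rw [← mul_sub]
      refine abs_integral_mul_le H (Eventually.of_forall fun r => ?_)
      exact (abs_tanh_mul_sub_le _ _ _ _).trans (by gcongr; exact hfield r)
    refine (norm_add_le _ _).trans ?_
    rw [norm_neg, norm_mul, Real.norm_eq_abs, Real.norm_eq_abs, Real.norm_eq_abs]
    calc _ ≤ M * ‖H‖ * R + (|p 0| + |p 1|) * (‖H‖ * (|β| * (2 * (M * ‖J‖ * R)))) := by
          gcongr
          · exact ih i H s hs'
          · exact hp i
      _ = K * (M * ‖H‖ * R) := by rw [hK]; ring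

/-- Uniqueness of weak solutions. -/
theorem ae_eq (hm : IsWeakSolution T β J θ a p m₀ m) (hm' : IsWeakSolution T β J θ a p m₀ m')
    (i : Fin 2) {t : ℝ} (ht : t ∈ Set.Icc 0 T) : m' i t =ᵐ[volume] m i t := by
  obtain ⟨C, hC⟩ := hm.bounded
  obtain ⟨C', hC'⟩ := hm'.bounded
  obtain ⟨M, hM, hbd⟩ := hm.abs_integral_sub_le hm'
  have h0 : ∀ H : C(Torus d, ℝ), ∫ r, H r * (m' i t r - m i t r) = 0 := by
    intro H
    simp_rw [mul_sub]
    rw [integral_sub (integrable_mul_of_integrable H (hm'.integrable i ht))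
      (integrable_mul_of_integrable H (hm.integrable i ht)), ← abs_nonpos_iff]
    refine ge_of_tendsto' (x := atTop) (f := fun n : ℕ => M * ‖H‖ *
      (((1 + (|p 0| + |p 1|) * (|β| * (2 * ‖J‖))) * t) ^ n / n.factorial)) ?_
      fun n => hbd n i H t ht
    simpa using (FloorSemiring.tendsto_pow_div_factorial_atTop
      ((1 + (|p 0| + |p 1|) * (|β| * (2 * ‖J‖))) * t)).const_mul (M * ‖H‖)
  have h1 := ae_eq_zero_of_forall_integral_continuous_mul (u := fun r => m' i t r - m i t r)
    (C := C' + C) ((hm'.aestronglyMeasurable i t ht).sub (hm.aestronglyMeasurable i t ht)) (by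
      filter_upwards [hC i t ht, hC' i t ht] with r h h'
      exact (abs_sub _ _).trans (add_le_add h' h)) h0
  filter_upwards [h1] with r hr
  simpa [sub_eq_zero] using hr

end IsWeakSolution

end Uniqueness

/-! ### Expectations under the semigroup -/

section Semigroup

variable {S : Type*} [Fintype S] [DecidableEq S]

section Derivative

attribute [local instance] Matrix.linftyOpNormedRing Matrix.linftyOpNormedAlgebra

/-- The operator norm is a local choice serving only to differentiate the exponential; entrywise,
the statement does not involve it. -/
lemma Matrix.hasDerivAt_exp_smul_apply (M : Matrix S S ℝ) (i j : S) (t : ℝ) :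
    HasDerivAt (fun u : ℝ => NormedSpace.exp (u • M) i j) ((NormedSpace.exp (t • M) * M) i j) t := by
  have h := hasDerivAt_exp_smul_const (𝕂 := ℝ) M t
  exact hasDerivAt_pi.1 (hasDerivAt_pi.1 h i) j

end Derivative

/-- Grönwall's inequality for the expectations `∑ s, exp(tL)(s₀, s) Φ_t(s)`. -/
theorem sum_exp_mul_le_exp_mul {L : (S → ℝ) →ₗ[ℝ] (S → ℝ)} {s₀ : S} {T C : ℝ}
    (hq : ∀ t ∈ Set.Icc 0 T, ∀ s, 0 ≤ NormedSpace.exp (t • LinearMap.toMatrix' L) s₀ s)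
    {Φ Φ' : ℝ → S → ℝ}
    (hΦ : ∀ s, ∀ t ∈ Set.Icc 0 T, HasDerivWithinAt (fun t => Φ t s) (Φ' t s) (Set.Icc 0 T) t)
    (hL : ∀ t ∈ Set.Icc 0 T, ∀ s, L (Φ t) s + Φ' t s ≤ C * Φ t s) {t : ℝ}
    (ht : t ∈ Set.Icc 0 T) :
    ∑ s, NormedSpace.exp (t • LinearMap.toMatrix' L) s₀ s * Φ t s ≤
      Real.exp (C * t) * Φ 0 s₀ := by
  set M := LinearMap.toMatrix' L with hM
  have hder : ∀ t ∈ Set.Icc 0 T, HasDerivWithinAt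
      (fun t => ∑ s, NormedSpace.exp (t • M) s₀ s * Φ t s)
      (∑ s, NormedSpace.exp (t • M) s₀ s * (L (Φ t) s + Φ' t s)) (Set.Icc 0 T) t := by
    intro t ht
    have h := HasDerivWithinAt.fun_sum (u := Finset.univ) fun s (_ : s ∈ Finset.univ) =>
      ((Matrix.hasDerivAt_exp_smul_apply M s₀ s t).hasDerivWithinAt (s := Set.Icc 0 T)).mul
        (hΦ s t ht)
    -- Associativity moves the generator from the row of the exponential onto the function, so the
    -- derivative of E[Φ_t] is E[LΦ_t + ∂_tΦ_t].
    have e : ∑ s, ((NormedSpace.exp (t • M) * M) s₀ s * Φ t s +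
        NormedSpace.exp (t • M) s₀ s * Φ' t s) =
        ∑ s, NormedSpace.exp (t • M) s₀ s * (L (Φ t) s + Φ' t s) := by
      simp_rw [mul_add, Finset.sum_add_distrib]
      congr 1
      have e1 : L (Φ t) = M.mulVec (Φ t) := by
        rw [hM, LinearMap.toMatrix'_mulVec]
      have e2 := congrFun (Matrix.mulVec_mulVec (Φ t) (NormedSpace.exp (t • M)) M) s₀
      rw [← e1] at e2
      simpa [Matrix.mulVec, dotProduct] using e2.symm
    rw [← e]
    exact h
  have hder2 : ∀ t ∈ Set.Icc 0 T, HasDerivWithinAt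
      (fun t => Real.exp (-(C * t)) * ∑ s, NormedSpace.exp (t • M) s₀ s * Φ t s)
      (Real.exp (-(C * t)) * ∑ s, NormedSpace.exp (t • M) s₀ s *
        (L (Φ t) s + Φ' t s - C * Φ t s)) (Set.Icc 0 T) t := by
    intro t ht
    have h1 : HasDerivWithinAt (fun t : ℝ => Real.exp (-(C * t))) (Real.exp (-(C * t)) * (-C))
        (Set.Icc 0 T) t := by
      have : HasDerivAt (fun t : ℝ => -(C * t)) (-C) t := by
        simpa only [neg_mul, mul_one] using hasDerivAt_const_mul (-C) (x := t)
      exact this.exp.hasDerivWithinAt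
    have h := h1.mul (hder t ht)
    have e : Real.exp (-(C * t)) * (-C) * ∑ s, NormedSpace.exp (t • M) s₀ s * Φ t s +
        Real.exp (-(C * t)) * ∑ s, NormedSpace.exp (t • M) s₀ s * (L (Φ t) s + Φ' t s) =
        Real.exp (-(C * t)) * ∑ s, NormedSpace.exp (t • M) s₀ s *
          (L (Φ t) s + Φ' t s - C * Φ t s) := by
      rw [mul_assoc, ← mul_add, Finset.mul_sum, ← Finset.sum_add_distrib]
      congr 1
      exact Finset.sum_congr rfl fun s _ => by ring
    rw [← e]
    exact h
  -- The nonnegativity of the row at s₀ enters here, to integrate the pointwise bound `hL`.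
  have hanti : AntitoneOn
      (fun t => Real.exp (-(C * t)) * ∑ s, NormedSpace.exp (t • M) s₀ s * Φ t s)
      (Set.Icc 0 T) := by
    refine antitoneOn_of_hasDerivWithinAt_nonpos (convex_Icc 0 T)
      (fun t ht => (hder2 t ht).continuousWithinAt)
      (fun t ht => (hder2 t (interior_subset ht)).mono interior_subset) fun t ht => ?_
    have ht' := interior_subset ht
    refine mul_nonpos_of_nonneg_of_nonpos (Real.exp_pos _).le ?_
    refine Finset.sum_nonpos fun s _ => mul_nonpos_of_nonneg_of_nonpos (hq t ht' s) ?_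
    linarith [hL t ht' s]
  have h := hanti ⟨le_rfl, ht.1.trans ht.2⟩ ht ht.1
  have h0 : ∑ s, (1 : Matrix S S ℝ) s₀ s * Φ 0 s = Φ 0 s₀ := by
    simp [Matrix.one_apply]
  simp only [mul_zero, neg_zero, Real.exp_zero, one_mul, zero_smul, NormedSpace.exp_zero] at h
  rw [h0, Real.exp_neg, inv_mul_le_iff₀ (Real.exp_pos _)] at h
  exact h

end Semigroup

/-! ### One-time marginals of the chain -/

section MarkovChain

lemma CadlagPath.measurableSet_eval_eq {S : Type*} [TopologicalSpace S] [MeasurableSpace S]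
    [MeasurableSingletonClass S] {T : ℝ} (t : Set.Icc (0 : ℝ) T) (s : S) :
    MeasurableSet {w : CadlagPath T S | w.1 t = s} := by
  have h : Measurable fun w : CadlagPath T S => w.1 t :=
    (measurable_pi_apply t).comp measurable_subtype_coe
  exact h (measurableSet_singleton s)

variable {S : Type*} [Fintype S] [DecidableEq S] [TopologicalSpace S] [MeasurableSpace S]
  [MeasurableSingletonClass S] {T : ℝ} {L : (S → ℝ) →ₗ[ℝ] (S → ℝ)} {s₀ : S}
  {μ : Measure (CadlagPath T S)}

namespace IsMarkovChainLaw

/-- The finite-dimensional formula only covers paths at s₀ at time 0. With one time point it says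
that this event has full measure; with the times 0 and t it then gives the marginal. -/
lemma measureReal_eval_eq (h : IsMarkovChainLaw L s₀ μ) (t : Set.Icc (0 : ℝ) T) (s : S) :
    μ.real {w | w.1 t = s} =
      NormedSpace.exp ((t : ℝ) • LinearMap.toMatrix' L) s₀ s := by
  have := h.isProbabilityMeasure
  have h0T : (0 : ℝ) ∈ Set.Icc 0 T := ⟨le_rfl, t.2.1.trans t.2.2⟩
  have h1 := h.finiteDimensional 0 (fun _ => ⟨0, h0T⟩) (fun _ => s₀)
    (fun _ _ _ => le_rfl) rfl rfl
  have h2 := h.finiteDimensional 1 ![⟨0, h0T⟩, t] ![s₀, s] (by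
    intro i j hij
    fin_cases i <;> fin_cases j
    · exact le_rfl
    · exact t.2.1
    · exact absurd hij (by decide)
    · exact le_rfl) rfl rfl
  simp only [Finset.univ_eq_empty, Finset.prod_empty, forall_const] at h1
  simp only [Finset.univ_unique, Finset.prod_singleton] at h2
  have hae : ∀ᵐ w ∂μ, w.1 ⟨0, h0T⟩ = s₀ := by
    refine (mem_ae_iff_prob_eq_one (CadlagPath.measurableSet_eval_eq _ s₀)).2 ?_
    rwa [measureReal_def, ENNReal.toReal_eq_one_iff] at h1
  have h3 : μ.real {w | w.1 t = s} = μ.real {w | w.1 ⟨0, h0T⟩ = s₀ ∧ w.1 t = s} := by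
    refine measureReal_congr ?_
    filter_upwards [hae] with w hw
    exact propext ⟨fun h => ⟨hw, h⟩, fun h => h.2⟩
  rw [h3]
  have e : {w : CadlagPath T S | w.1 ⟨0, h0T⟩ = s₀ ∧ w.1 t = s} =
      {w | ∀ j : Fin (1 + 1), w.1 (![⟨0, h0T⟩, t] j) = ![s₀, s] j} := by
    ext w
    exact (Fin.forall_fin_two (p := fun j => w.1 (![⟨0, h0T⟩, t] j) = ![s₀, s] j)).symm
  rw [e, h2]
  simp

/-- Nonnegativity is read off from the law, as a probability, with no analysis of the generator. -/
lemma exp_nonneg (h : IsMarkovChainLaw L s₀ μ) {t : ℝ} (ht : t ∈ Set.Icc 0 T) (s : S) :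
    0 ≤ NormedSpace.exp (t • LinearMap.toMatrix' L) s₀ s := by
  rw [← h.measureReal_eval_eq ⟨t, ht⟩ s]
  exact measureReal_nonneg

/-- Chebyshev's inequality at a fixed time. -/
lemma measure_le_abs_eval (h : IsMarkovChainLaw L s₀ μ) (t : Set.Icc (0 : ℝ) T) (Y : S → ℝ)
    {δ : ℝ} (hδ : 0 < δ) :
    μ {w | δ ≤ |Y (w.1 t)|} ≤ ENNReal.ofReal
      ((∑ s, NormedSpace.exp ((t : ℝ) • LinearMap.toMatrix' L) s₀ s * Y s ^ 2) / δ ^ 2) := by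
  classical
  have := h.isProbabilityMeasure
  rw [← ENNReal.ofReal_toReal (measure_ne_top μ {w | _})]
  refine ENNReal.ofReal_le_ofReal ?_
  change μ.real _ ≤ _
  have hsub : {w : CadlagPath T S | δ ≤ |Y (w.1 t)|} ⊆
      ⋃ s ∈ Finset.univ.filter (fun s => δ ≤ |Y s|), {w | w.1 t = s} := by
    intro w hw
    simp only [Set.mem_iUnion]
    exact ⟨w.1 t, Finset.mem_filter.2 ⟨Finset.mem_univ _, hw⟩, rfl⟩
  calc _ ≤ ∑ s ∈ Finset.univ.filter (fun s => δ ≤ |Y s|), μ.real {w | w.1 t = s} :=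
        (measureReal_mono hsub (measure_ne_top _ _)).trans (measureReal_biUnion_finset_le _ _)
    _ ≤ ∑ s ∈ Finset.univ.filter (fun s => δ ≤ |Y s|),
          μ.real {w | w.1 t = s} * (Y s ^ 2 / δ ^ 2) := by
        refine Finset.sum_le_sum fun s hs => ?_
        have hs' := (Finset.mem_filter.1 hs).2
        refine le_mul_of_one_le_right measureReal_nonneg ?_
        rw [one_le_div (by positivity), ← sq_abs (Y s)]
        gcongr
    _ ≤ ∑ s, μ.real {w | w.1 t = s} * (Y s ^ 2 / δ ^ 2) :=
        Finset.sum_le_sum_of_subset_of_nonneg (Finset.filter_subset _ _) fun s _ _ =>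
          mul_nonneg measureReal_nonneg (by positivity)
    _ = _ := by
        rw [Finset.sum_div]
        refine Finset.sum_congr rfl fun s _ => ?_
        rw [h.measureReal_eval_eq t s, mul_div_assoc]

end IsMarkovChainLaw

end MarkovChain

instance : MeasurableSingletonClass ℤˣ where
  measurableSet_singleton u :=
    ⟨{(u : ℤ)}, measurableSet_singleton _, by ext v; simp [Units.ext_iff]⟩

/-! ### Flip rates and the drift of squared linear statistics -/

section Generator

variable {d n : ℕ}

lemma spin_sq (σ : SpinConfig d n) (x : DiscTorus d n) : spin σ x * spin σ x = 1 := by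
  rcases Int.units_eq_one_or (σ x) with h | h <;> simp [spin, h]

lemma abs_spin (σ : SpinConfig d n) (x : DiscTorus d n) : |spin σ x| = 1 := by
  rcases Int.units_eq_one_or (σ x) with h | h <;> simp [spin, h]

lemma spin_flipSpin (σ : SpinConfig d n) (x y : DiscTorus d n) :
    spin (flipSpin σ x) y = spin σ y + if y = x then -2 * spin σ x else 0 := by
  unfold flipSpin spin
  by_cases h : y = x
  · subst h; simp; ring
  · simp [h]

variable [NeZero n] {β : ℝ} {J : Torus d → ℝ} {θ : ℝ} {α : (Fin d → ℤ) → ℝ}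

lemma sum_mul_spin_flipSpin (w : DiscTorus d n → ℝ) (σ : SpinConfig d n) (x : DiscTorus d n) :
    ∑ y, w y * spin (flipSpin σ x) y = ∑ y, w y * spin σ y - 2 * (w x * spin σ x) := by
  simp_rw [spin_flipSpin, mul_add, Finset.sum_add_distrib]
  simp
  ring

/-- The field `∑_y J_γ(x, y) σ(y)` at the site `x`. -/
noncomputable def localField (J : Torus d → ℝ) (σ : SpinConfig d n) (x : DiscTorus d n) : ℝ :=
  ∑ y, kacPotential J x y * spin σ y

/-- The field felt by the spin at `x`: no self-interaction, external field included. -/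
noncomputable def effectiveField (J : Torus d → ℝ) (θ : ℝ) (α : (Fin d → ℤ) → ℝ)
    (σ : SpinConfig d n) (x : DiscTorus d n) : ℝ :=
  localField J σ x - kacPotential J x x * spin σ x + inducedField n α x * θ

lemma kacPotential_comm (hJ : ∀ r, J (-r) = J r) (x y : DiscTorus d n) :
    kacPotential J x y = kacPotential J y x := by
  unfold kacPotential
  rw [scaledSite_sub, scaledSite_sub, ← hJ, neg_sub]

/-- By symmetry of J the flipped spin meets every other spin twice in the quadratic form. The
diagonal term does not see the flip, hence its removal from `effectiveField`. -/
lemma hamiltonian_flipSpin_sub (hJ : ∀ r, J (-r) = J r) (σ : SpinConfig d n)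
    (x : DiscTorus d n) : hamiltonian J θ α (flipSpin σ x) - hamiltonian J θ α σ =
      2 * (spin σ x * effectiveField J θ α σ x) := by
  have h1 : ∀ σ' : SpinConfig d n, (∑ y, ∑ z, kacPotential J y z * spin σ' y * spin σ' z)
      = ∑ y, localField J σ' y * spin σ' y := by
    intro σ'
    refine Finset.sum_congr rfl fun y _ => ?_
    rw [localField, Finset.sum_mul]
    exact Finset.sum_congr rfl fun z _ => by ring
  have h2 : ∀ y, localField J (flipSpin σ x) y =
      localField J σ y - 2 * (kacPotential J y x * spin σ x) := fun y =>
    sum_mul_spin_flipSpin _ σ x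
  unfold hamiltonian
  rw [h1, h1, sum_mul_spin_flipSpin, sum_mul_spin_flipSpin]
  simp_rw [h2, sub_mul, Finset.sum_sub_distrib]
  have h3 : ∑ y, 2 * (kacPotential J y x * spin σ x) * spin σ y =
      2 * spin σ x * localField J σ x := by
    rw [localField, Finset.mul_sum]
    refine Finset.sum_congr rfl fun y _ => ?_
    rw [kacPotential_comm hJ y x]
    ring
  rw [h3]
  unfold effectiveField
  linear_combination (0 : ℝ) * spin_sq σ x

/-- From e^{-u} / (2 cosh u) = (1 - tanh u) / 2; since tanh is odd, the sign σ(x) comes out. The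
drift -2σ(x)c_x of the spin is then -σ(x) + tanh(β h_x). -/
lemma flipRate_eq (hJ : ∀ r, J (-r) = J r) (σ : SpinConfig d n) (x : DiscTorus d n) :
    flipRate β J θ α x σ =
      (1 - spin σ x * Real.tanh (β * effectiveField J θ α σ x)) / 2 := by
  have h : ∀ u : ℝ, Real.exp (-u) / (2 * Real.cosh u) = (1 - Real.tanh u) / 2 := by
    intro u
    have := (Real.cosh_pos u).ne'
    rw [← Real.cosh_sub_sinh, Real.tanh_eq_sinh_div_cosh]
    field_simp
  unfold flipRate
  rw [hamiltonian_flipSpin_sub hJ, neg_mul, h]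
  have e : β / 2 * (2 * (spin σ x * effectiveField J θ α σ x)) =
      spin σ x * (β * effectiveField J θ α σ x) := by ring
  rw [e]
  congr 2
  rcases Int.units_eq_one_or (σ x) with hx | hx <;> simp [spin, hx, Real.tanh_neg]

lemma flipRate_le_one (hJ : ∀ r, J (-r) = J r) (σ : SpinConfig d n) (x : DiscTorus d n) :
    flipRate β J θ α x σ ≤ 1 := by
  rw [flipRate_eq hJ]
  have h : |spin σ x * Real.tanh (β * effectiveField J θ α σ x)| ≤ 1 := by
    rw [abs_mul, abs_spin, one_mul]
    exact (Real.abs_tanh_lt_one _).le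
  linarith [(abs_le.1 h).1]

/-- The generator applied to the square of an affine function of the spins. -/
lemma glauberGenerator_sq (hJ : ∀ r, J (-r) = J r) (w : DiscTorus d n → ℝ) (c : ℝ)
    (σ : SpinConfig d n) :
    glauberGenerator β J θ α (fun σ => (∑ x, w x * spin σ x - c) ^ 2) σ =
      2 * (∑ x, w x * spin σ x - c) *
        (∑ x, w x * Real.tanh (β * effectiveField J θ α σ x) - ∑ x, w x * spin σ x) +
      4 * ∑ x, w x ^ 2 * flipRate β J θ α x σ := by
  change ∑ x, flipRate β J θ α x σ * ((∑ y, w y * spin (flipSpin σ x) y - c) ^ 2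
    - (∑ y, w y * spin σ y - c) ^ 2) = _
  simp_rw [sum_mul_spin_flipSpin]
  set W := ∑ x, w x * spin σ x
  rw [← Finset.sum_sub_distrib, Finset.mul_sum, Finset.mul_sum, ← Finset.sum_add_distrib]
  refine Finset.sum_congr rfl fun x _ => ?_
  rw [flipRate_eq hJ]
  -- A flip at x changes W by -2w(x)σ(x); after expanding the square, only σ(x)² = 1 is needed.
  linear_combination (2 * (W - c) * w x * Real.tanh (β * effectiveField J θ α σ x) +
    2 * w x ^ 2 * (1 - spin σ x * Real.tanh (β * effectiveField J θ α σ x))) * spin_sq σ x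

/-- The drift of the square of an affine function of the spins, compared with the limit field. -/
lemma glauberGenerator_sq_add_le (hJ : ∀ r, J (-r) = J r) (hβ : 0 ≤ β) {B : ℝ}
    (hJB : ∀ r, |J r| ≤ B) {b : DiscTorus d n → ℝ} (hb : ∀ x, |b x| ≤ B) (c ρ : ℝ)
    (f : DiscTorus d n → ℝ) (σ : SpinConfig d n) :
    glauberGenerator β J θ α
        (fun σ => (∑ x, ((n : ℝ)⁻¹) ^ d * b x * spin σ x - c) ^ 2) σ +
        2 * (∑ x, ((n : ℝ)⁻¹) ^ d * b x * spin σ x - c) * (c - ρ) ≤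
      B * β * ((∑ x, ((n : ℝ)⁻¹) ^ d * b x * spin σ x - c) ^ 2 +
        ((n : ℝ)⁻¹) ^ d * ∑ x, (localField J σ x - f x) ^ 2) +
      (B * β * (B * ((n : ℝ)⁻¹) ^ d)) ^ 2 + 4 * B ^ 2 * ((n : ℝ)⁻¹) ^ d +
      (((n : ℝ)⁻¹) ^ d * ∑ x, b x * Real.tanh (β * (f x + inducedField n α x * θ)) - ρ) ^ 2 := by
  rw [glauberGenerator_sq hJ]
  have hcard := card_mul_inv_pow (d := d) (n := n)
  set g : ℝ := ((n : ℝ)⁻¹) ^ d with hg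
  have hg0 : 0 ≤ g := by positivity
  have hB : 0 ≤ B := (abs_nonneg _).trans (hJB 0)
  set Y : ℝ := ∑ x, g * b x * spin σ x - c with hY
  set R : ℝ := g * ∑ x, b x * Real.tanh (β * (f x + inducedField n α x * θ)) - ρ with hR
  -- The jump variance: about 1/g sites, each contributing order g².
  have hrate : 4 * ∑ x, (g * b x) ^ 2 * flipRate β J θ α x σ ≤ 4 * B ^ 2 * g := by
    have h : ∀ x : DiscTorus d n, (g * b x) ^ 2 * flipRate β J θ α x σ ≤ g * (g * B ^ 2) := by
      intro x
      have h1 : b x ^ 2 ≤ B ^ 2 := by rw [← sq_abs]; gcongr; exact hb x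
      calc _ ≤ (g * b x) ^ 2 * 1 := by gcongr; exact flipRate_le_one hJ σ x
        _ = g * (g * b x ^ 2) := by ring
        _ ≤ _ := by gcongr
    have h2 := Finset.sum_le_sum fun x (_ : x ∈ Finset.univ) => h x
    rw [Finset.sum_const, Finset.card_univ, nsmul_eq_mul, ← mul_assoc, hcard, one_mul] at h2
    linarith
  -- Replacing the true field by the limit field costs their distance plus the self-interaction, at
  -- most B g.
  have hdiff : ∀ x, |Real.tanh (β * effectiveField J θ α σ x) -
      Real.tanh (β * (f x + inducedField n α x * θ))| ≤
        β * (|localField J σ x - f x| + B * g) := by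
    intro x
    refine (abs_tanh_mul_sub_le β (inducedField n α x * θ)
      (localField J σ x - kacPotential J x x * spin σ x) (f x)).trans ?_
    rw [abs_of_nonneg hβ]
    gcongr
    have h1 : |kacPotential J x x * spin σ x| ≤ B * g := by
      rw [abs_mul, abs_spin, mul_one, kacPotential, abs_mul, abs_of_nonneg (by positivity),
        mul_comm B]
      gcongr
      exact hJB _
    have e : localField J σ x - kacPotential J x x * spin σ x - f x =
      (localField J σ x - f x) - kacPotential J x x * spin σ x := by ring
    rw [e]
    exact (abs_sub _ _).trans (by gcongr)
  have hsplit : ∑ x, g * b x * Real.tanh (β * effectiveField J θ α σ x) - ∑ x, g * b x * spin σ x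
      + (c - ρ) = (∑ x, g * b x * (Real.tanh (β * effectiveField J θ α σ x) -
        Real.tanh (β * (f x + inducedField n α x * θ)))) + R - Y := by
    rw [hR, hY, Finset.mul_sum]
    simp_rw [mul_sub, Finset.sum_sub_distrib]
    simp_rw [mul_assoc]
    ring
  have hmain : 2 * Y * (∑ x, g * b x * (Real.tanh (β * effectiveField J θ α σ x) -
        Real.tanh (β * (f x + inducedField n α x * θ)))) ≤
      B * β * (Y ^ 2 + g * ∑ x, (localField J σ x - f x) ^ 2) +
        (Y ^ 2 + (B * β * (B * g)) ^ 2) := by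
    have h : ∀ x, 2 * Y * (g * b x * (Real.tanh (β * effectiveField J θ α σ x) -
        Real.tanh (β * (f x + inducedField n α x * θ)))) ≤
        g * (B * β * (Y ^ 2 + (localField J σ x - f x) ^ 2) +
          (Y ^ 2 + (B * β * (B * g)) ^ 2)) := by
      intro x
      set D := Real.tanh (β * effectiveField J θ α σ x) -
        Real.tanh (β * (f x + inducedField n α x * θ))
      set X := localField J σ x - f x
      have h1 : |Y * (b x * D)| ≤ |Y| * (B * (β * (|X| + B * g))) := by
        rw [abs_mul, abs_mul]
        gcongr
        · exact hb x
        · exact hdiff x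
      have h2 : 2 * (|Y| * (B * (β * (|X| + B * g)))) ≤
          B * β * (Y ^ 2 + X ^ 2) + (Y ^ 2 + (B * β * (B * g)) ^ 2) := by
        have h3 : 2 * (|Y| * |X|) ≤ Y ^ 2 + X ^ 2 := by
          rw [← sq_abs Y, ← sq_abs X]
          linarith [two_mul_le_add_sq |Y| |X|]
        have h4 : 2 * (|Y| * (B * β * (B * g))) ≤ Y ^ 2 + (B * β * (B * g)) ^ 2 := by
          rw [← sq_abs Y]
          linarith [two_mul_le_add_sq |Y| (B * β * (B * g))]
        have h5 := mul_le_mul_of_nonneg_left h3 (by positivity : 0 ≤ B * β)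
        linarith
      calc _ = g * (2 * (Y * (b x * D))) := by ring
        _ ≤ _ := by
            gcongr
            linarith [le_abs_self (Y * (b x * D))]
    rw [Finset.mul_sum]
    refine (Finset.sum_le_sum fun x _ => h x).trans (le_of_eq ?_)
    rw [← Finset.mul_sum, Finset.sum_add_distrib, ← Finset.mul_sum, Finset.sum_add_distrib,
      Finset.sum_const, Finset.sum_const, Finset.card_univ, nsmul_eq_mul, nsmul_eq_mul]
    linear_combination (B * β * Y ^ 2 + Y ^ 2 + (B * β * (B * g)) ^ 2) * hcard
  have hfin : 2 * Y * R ≤ Y ^ 2 + R ^ 2 := two_mul_le_add_sq Y R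
  -- The relaxation term supplies -2Y², which cancels the two Y² produced by Young's inequality in
  -- `hmain` and `hfin`.
  have e : 2 * Y * (∑ x, g * b x * Real.tanh (β * effectiveField J θ α σ x) -
      ∑ x, g * b x * spin σ x) + 2 * Y * (c - ρ) =
      2 * Y * (∑ x, g * b x * (Real.tanh (β * effectiveField J θ α σ x) -
        Real.tanh (β * (f x + inducedField n α x * θ)))) + 2 * Y * R - 2 * Y ^ 2 := by
    rw [← mul_add, hsplit]; ring
  linarith

end Generator

/-! ### Colored weights and their law-of-large-numbers errors -/

section Colors

variable {d n : ℕ} {a : Fin 2 → ℝ} {α : (Fin d → ℤ) → ℝ}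

/-- As a₀ ≠ a₁, exactly one indicator is 1, so a sum over colors collapses to the color of the site.
-/
lemma exists_color (ha : a 0 ≠ a 1) (hα : ∀ x, ∃ i, α x = a i) (x : DiscTorus d n) :
    ∃ i, inducedField n α x = a i ∧
      ∀ φ : Fin 2 → ℝ, ∑ j, φ j * colorIndicator α (a j) x = φ i := by
  obtain ⟨i, hi⟩ := hα (fun j => (x j).valMinAbs)
  have hi' : inducedField n α x = a i := hi
  refine ⟨i, hi', fun φ => ?_⟩
  rw [Fin.sum_univ_two]
  unfold colorIndicator
  rw [hi']
  fin_cases i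
  · simp [ha]
  · simp [ha.symm]

variable [NeZero n]

/-- The weight `∑_i G_i(γx) 1{α(x) = a_i}` of the site `x`. -/
noncomputable def coloredWeight (a : Fin 2 → ℝ) (α : (Fin d → ℤ) → ℝ)
    (G : Fin 2 → C(Torus d, ℝ)) (x : DiscTorus d n) : ℝ :=
  ∑ i, G i (scaledSite x) * colorIndicator α (a i) x

lemma abs_coloredWeight_le (ha : a 0 ≠ a 1) (hα : ∀ x, ∃ i, α x = a i)
    {G : Fin 2 → C(Torus d, ℝ)} {B : ℝ} (hG : ∀ i, ‖G i‖ ≤ B) (x : DiscTorus d n) :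
    |coloredWeight a α G x| ≤ B := by
  obtain ⟨i, -, hi⟩ := exists_color ha hα x
  rw [coloredWeight, hi fun j => G j (scaledSite x)]
  exact ((G i).norm_coe_le_norm _).trans (hG i)

lemma coloredPairing_eq (G : Fin 2 → C(Torus d, ℝ)) (σ : SpinConfig d n) :
    coloredPairing a α σ (fun i => G i) =
      ∑ x, ((n : ℝ)⁻¹) ^ d * coloredWeight a α G x * spin σ x := by
  unfold coloredPairing coloredWeight
  simp_rw [Finset.mul_sum, Finset.sum_mul]
  rw [Finset.sum_comm]
  refine Finset.sum_congr rfl fun x _ => Finset.sum_congr rfl fun i _ => ?_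
  unfold colorIndicator
  ring

/-- The deviation of the colored average of `H` from its limit `p ∫ H`. -/
noncomputable def colorError (n : ℕ) [NeZero n] (α : (Fin d → ℤ) → ℝ) (a p : ℝ)
    (H : C(Torus d, ℝ)) : ℝ :=
  ((n : ℝ)⁻¹) ^ d * ∑ x : DiscTorus d n, H (scaledSite x) * colorIndicator α a x - p * ∫ r, H r

lemma abs_colorError_sub_le (a p : ℝ) (H H' : C(Torus d, ℝ)) :
    |colorError n α a p H - colorError n α a p H'| ≤ (1 + |p|) * dist H H' := by
  have h : ∀ r, |H r - H' r| ≤ dist H H' := fun r => by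
    rw [← Real.dist_eq]; exact ContinuousMap.dist_apply_le_dist r
  have e : colorError n α a p H - colorError n α a p H' =
      ((n : ℝ)⁻¹) ^ d * ∑ x : DiscTorus d n,
        (H (scaledSite x) - H' (scaledSite x)) * colorIndicator α a x -
      p * ∫ r, (H r - H' r) := by
    rw [integral_sub (Torus.integrable_of_continuous H.continuous)
      (Torus.integrable_of_continuous H'.continuous)]
    simp_rw [sub_mul, Finset.sum_sub_distrib]
    unfold colorError
    ring
  rw [e, add_mul, one_mul]
  refine (abs_sub _ _).trans (add_le_add (abs_inv_pow_mul_sum_le fun x => ?_) ?_)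
  · rw [abs_mul, ← mul_one (dist H H')]
    exact mul_le_mul (h _) (abs_colorIndicator_le _ _ _) (abs_nonneg _) dist_nonneg
  · rw [abs_mul]
    gcongr
    exact Torus.abs_integral_le _ h

/-- At a site of color i the tanh is the i-th response, so with the limit field inserted the error
in the drift is purely one of color averages. -/
lemma coloredWeight_response_sub (ha : a 0 ≠ a 1) (hα : ∀ x, ∃ i, α x = a i) (p : Fin 2 → ℝ)
    (β θ : ℝ) (G : Fin 2 → C(Torus d, ℝ)) (f : C(Torus d, ℝ)) :
    ((n : ℝ)⁻¹) ^ d * ∑ x : DiscTorus d n, coloredWeight a α G x *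
        Real.tanh (β * (f (scaledSite x) + inducedField n α x * θ)) -
      ∑ i, p i * ∫ r, G i r * response β θ (a i) f r =
    ∑ i, colorError n α (a i) (p i) (G i * response β θ (a i) f) := by
  unfold colorError
  rw [Finset.sum_sub_distrib, ← Finset.mul_sum, Finset.sum_comm]
  congr 2
  refine Finset.sum_congr rfl fun x _ => ?_
  obtain ⟨i, hi, hφ⟩ := exists_color ha hα x
  rw [coloredWeight, hφ fun j => G j (scaledSite x),
    hφ fun j => (G j * response β θ (a j) f) (scaledSite x), hi]
  rfl

/-- Testing both colors against the same function forgets the colors; local fields thereby become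
colored pairings, under the same drift estimate. -/
lemma coloredWeight_kernelSection (ha : a 0 ≠ a 1) (hα : ∀ x, ∃ i, α x = a i) (J : C(Torus d, ℝ))
    (z x : DiscTorus d n) :
    coloredWeight a α (fun _ => kernelSection J (scaledSite z)) x = J (scaledSite (z - x)) := by
  obtain ⟨i, -, hφ⟩ := exists_color ha hα x
  rw [coloredWeight, hφ fun _ => kernelSection J (scaledSite z) (scaledSite x),
    kernelSection_apply, scaledSite_sub]

end Colors

/-! ### Second-moment bound along the limit flow -/

section Flow

variable {d : ℕ}

/-- Integration against a continuous function, as a functional on `C(Λ)`. -/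
noncomputable def integralAgainst (G : C(Torus d, ℝ)) : C(Torus d, ℝ) →L[ℝ] ℝ :=
  LinearMap.mkContinuous
    { toFun := fun u => ∫ r, G r * u r
      map_add' := fun u w => by
        rw [← integral_add (Torus.integrable_of_continuous (by fun_prop))
          (Torus.integrable_of_continuous (by fun_prop))]
        simp [mul_add]
      map_smul' := fun c u => by
        rw [RingHom.id_apply, smul_eq_mul, ← integral_const_mul]
        exact integral_congr_ae (Eventually.of_forall fun r => by
          simp only [ContinuousMap.coe_smul, Pi.smul_apply, smul_eq_mul]; ring) }
    ‖G‖ fun u => abs_integral_mul_le G (Eventually.of_forall fun r => u.norm_coe_le_norm r)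

variable {J : C(Torus d, ℝ)} {β θ : ℝ} {a p : Fin 2 → ℝ} {T : ℝ} {v : ℝ → Fin 2 → C(Torus d, ℝ)}

lemma hasDerivWithinAt_sum_integral
    (hv : ∀ t ∈ Set.Icc 0 T,
      HasDerivWithinAt v (-v t + fun i => p i • response β θ (a i) (meanField J (v t)))
        (Set.Icc 0 T) t) (G : Fin 2 → C(Torus d, ℝ)) {t : ℝ} (ht : t ∈ Set.Icc 0 T) :
    HasDerivWithinAt (fun t => ∑ i, ∫ r, G i r * v t i r)
      (-(∑ i, ∫ r, G i r * v t i r) +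
        ∑ i, p i * ∫ r, G i r * response β θ (a i) (meanField J (v t)) r) (Set.Icc 0 T) t := by
  rw [← Finset.sum_neg_distrib, ← Finset.sum_add_distrib]
  refine HasDerivWithinAt.fun_sum fun i _ => ?_
  have h1 : HasDerivWithinAt (fun s => v s i)
      (-v t i + p i • response β θ (a i) (meanField J (v t))) (Set.Icc 0 T) t :=
    (hasDerivWithinAt_pi.1 (hv t ht)) i
  have h2 := (integralAgainst (G i)).hasFDerivAt.comp_hasDerivWithinAt t h1
  rw [map_add, map_neg, map_smul] at h2
  exact h2

end Flow

section MomentBound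

variable {d n : ℕ} [NeZero n] {J : C(Torus d, ℝ)} {β θ : ℝ} {a p : Fin 2 → ℝ} {T : ℝ}
  {α : (Fin d → ℤ) → ℝ} {v : ℝ → Fin 2 → C(Torus d, ℝ)}

lemma glauberGenerator_const (c : ℝ) (σ : SpinConfig d n) :
    glauberGenerator β J θ α (fun _ => c) σ = 0 := by
  change ∑ x, flipRate β J θ α x σ * (c - c) = 0
  simp

/-- The mean square distance between the empirical fields and a limit field. -/
noncomputable def fieldError (J f : C(Torus d, ℝ)) (σ : SpinConfig d n) : ℝ :=
  ((n : ℝ)⁻¹) ^ d * ∑ z, (localField J σ z - f (scaledSite z)) ^ 2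

/-- The second moment of the deviation of the colored empirical measures from the limit flow. -/
theorem sum_exp_mul_sq_le (ha : a 0 ≠ a 1) (hα : ∀ x, ∃ i, α x = a i)
    (hJ : ∀ r, J (-r) = J r) (hβ : 0 ≤ β)
    (hv : ∀ t ∈ Set.Icc 0 T,
      HasDerivWithinAt v (-v t + fun i => p i • response β θ (a i) (meanField J (v t)))
        (Set.Icc 0 T) t)
    (G : Fin 2 → C(Torus d, ℝ)) {B : ℝ} (hJB : ‖J‖ ≤ B) (hGB : ∀ i, ‖G i‖ ≤ B) {s₀ : SpinConfig d n}
    (hq : ∀ t ∈ Set.Icc 0 T, ∀ s, 0 ≤ NormedSpace.exp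
      (t • LinearMap.toMatrix' (glauberGenerator β J θ α)) s₀ s) {η : ℝ} (hη : 0 ≤ η)
    (hg : 2 * ((B * β * (B * ((n : ℝ)⁻¹) ^ d)) ^ 2 + 4 * B ^ 2 * ((n : ℝ)⁻¹) ^ d) ≤ η / 2)
    (hRJ : ∀ t ∈ Set.Icc 0 T, ∀ r, (∑ i, colorError n α (a i) (p i)
      (kernelSection J r * response β θ (a i) (meanField J (v t)))) ^ 2 ≤ η / 4)
    (hRG : ∀ t ∈ Set.Icc 0 T, (∑ i, colorError n α (a i) (p i)
      (G i * response β θ (a i) (meanField J (v t)))) ^ 2 ≤ η / 4)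
    {t : ℝ} (ht : t ∈ Set.Icc 0 T) :
    ∑ s, NormedSpace.exp (t • LinearMap.toMatrix' (glauberGenerator β J θ α)) s₀ s *
        (coloredPairing a α s (fun i => G i) - ∑ i, ∫ r, G i r * v t i r) ^ 2 ≤
      Real.exp ((3 * (B * β) + 1) * t) * (fieldError J (meanField J (v 0)) s₀ +
        (coloredPairing a α s₀ (fun i => G i) - ∑ i, ∫ r, G i r * v 0 i r) ^ 2 + η) := by
  have hB : 0 ≤ B := (norm_nonneg J).trans hJB
  set g : ℝ := ((n : ℝ)⁻¹) ^ d with hgdef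
  have hg0 : 0 ≤ g := by positivity
  have hcard := card_mul_inv_pow (d := d) (n := n)
  rw [← hgdef] at hcard
  let GJ : DiscTorus d n → Fin 2 → C(Torus d, ℝ) := fun z _ => kernelSection J (scaledSite z)
  let c : (Fin 2 → C(Torus d, ℝ)) → ℝ → ℝ := fun G t => ∑ i, ∫ r, G i r * v t i r
  let ρ : (Fin 2 → C(Torus d, ℝ)) → ℝ → ℝ := fun G t =>
    ∑ i, p i * ∫ r, G i r * response β θ (a i) (meanField J (v t)) r
  let Q : (Fin 2 → C(Torus d, ℝ)) → ℝ → SpinConfig d n → ℝ := fun G t s =>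
    (∑ x, g * coloredWeight a α G x * spin s x - c G t) ^ 2
  let Q' : (Fin 2 → C(Torus d, ℝ)) → ℝ → SpinConfig d n → ℝ := fun G t s =>
    2 * (∑ x, g * coloredWeight a α G x * spin s x - c G t) * (c G t - ρ G t)
  have hQ : ∀ G s, ∀ t ∈ Set.Icc 0 T,
      HasDerivWithinAt (fun t => Q G t s) (Q' G t s) (Set.Icc 0 T) t := by
    intro G s t ht
    have h1 := (hasDerivWithinAt_sum_integral hv G ht).const_sub
      (∑ x, g * coloredWeight a α G x * spin s x)
    have h2 := h1.fun_pow 2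
    have e : Q' G t s = ((2 : ℕ) : ℝ) *
        (∑ x, g * coloredWeight a α G x * spin s x - c G t) ^ (2 - 1) *
        -(-c G t + ρ G t) := by
      simp only [Q']
      norm_num
      left
      ring
    rw [e]
    exact h2
  have hfield : ∀ t s z, ∑ x, g * coloredWeight a α (GJ z) x * spin s x - c (GJ z) t =
      localField J s z - meanField J (v t) (scaledSite z) := by
    intro t s z
    simp only [GJ, c]
    rw [meanField_eq_sum]
    simp_rw [coloredWeight_kernelSection ha hα]
    rfl
  have hFE : ∀ t s, fieldError J (meanField J (v t)) s = g * ∑ z, Q (GJ z) t s := by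
    intro t s
    simp only [Q, hfield]
    rfl
  have hLQ : ∀ G : Fin 2 → C(Torus d, ℝ), (∀ i, ‖G i‖ ≤ B) → ∀ t ∈ Set.Icc 0 T,
      (∑ i, colorError n α (a i) (p i)
        (G i * response β θ (a i) (meanField J (v t)))) ^ 2 ≤ η / 4 → ∀ s,
      glauberGenerator β J θ α (Q G t) s + Q' G t s ≤
        B * β * (Q G t s + fieldError J (meanField J (v t)) s) +
          ((B * β * (B * g)) ^ 2 + 4 * B ^ 2 * g) + η / 4 := by
    intro G hG t ht hR s
    have h := glauberGenerator_sq_add_le (θ := θ) (α := α) hJ hβ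
      (fun r => (J.norm_coe_le_norm r).trans hJB)
      (abs_coloredWeight_le ha hα hG (n := n)) (c G t) (ρ G t)
      (fun z => meanField J (v t) (scaledSite z)) s
    rw [coloredWeight_response_sub ha hα] at h
    refine h.trans ?_
    simp only [Q, fieldError, ← hgdef]
    linarith
  -- The averaged squares over all sites z make the field error part of the functional; the constant
  -- η lets additive errors be absorbed in a homogeneous Grönwall bound.
  let Φ : ℝ → SpinConfig d n → ℝ := fun t => g • (∑ z, Q (GJ z) t) + Q G t + fun _ => η
  let Φ' : ℝ → SpinConfig d n → ℝ := fun t s => g * (∑ z, Q' (GJ z) t s) + Q' G t s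
  have hΦapp : ∀ t s, Φ t s = fieldError J (meanField J (v t)) s + Q G t s + η := by
    intro t s
    rw [hFE]
    simp [Φ]
  have hQnn : ∀ G t s, 0 ≤ Q G t s := fun G t s => sq_nonneg _
  have hFEnn : ∀ t s, 0 ≤ fieldError J (meanField J (v t)) s := fun t s =>
    mul_nonneg hg0 (Finset.sum_nonneg fun z _ => sq_nonneg _)
  -- The field part contributes 2Bβ times the field error and the Ḡ part Bβ times both squares,
  -- whence 3Bβ. The remaining errors total at most η/2 + η/4 + η/4 = η, which the extra 1 pays for.
  have hmain := sum_exp_mul_le_exp_mul (C := 3 * (B * β) + 1) hq (Φ := Φ) (Φ' := Φ')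
    (fun s t ht => by
      have h1 := (((HasDerivWithinAt.fun_sum (u := Finset.univ) fun z (_ : z ∈ Finset.univ) =>
        hQ (GJ z) s t ht).const_mul g).add (hQ G s t ht)).add_const η
      refine h1.congr_of_eventuallyEq (Eventually.of_forall fun t => ?_) ?_
      · simp [Φ]
      · simp [Φ])
    (fun t ht s => by
      have e : glauberGenerator β J θ α (Φ t) s =
          g * (∑ z, glauberGenerator β J θ α (Q (GJ z) t) s) +
            glauberGenerator β J θ α (Q G t) s := by
        simp only [Φ, map_add, map_smul, map_sum, Pi.add_apply, Pi.smul_apply, Finset.sum_apply,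
          smul_eq_mul, glauberGenerator_const, add_zero]
      have h1 := hLQ G hGB t ht (hRG t ht) s
      have h2 : g * ∑ z, (glauberGenerator β J θ α (Q (GJ z) t) s + Q' (GJ z) t s) ≤
          B * β * (2 * fieldError J (meanField J (v t)) s) +
            ((B * β * (B * g)) ^ 2 + 4 * B ^ 2 * g) + η / 4 := by
        calc _ ≤ g * ∑ z, (B * β * (Q (GJ z) t s + fieldError J (meanField J (v t)) s) +
              ((B * β * (B * g)) ^ 2 + 4 * B ^ 2 * g) + η / 4) := by
              refine mul_le_mul_of_nonneg_left (Finset.sum_le_sum fun z _ => ?_) hg0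
              exact hLQ (GJ z) (fun _ => (norm_kernelSection_le J _).trans hJB) t ht
                (hRJ t ht (scaledSite z)) s
          _ = _ := by
              simp_rw [Finset.sum_add_distrib, ← Finset.mul_sum, Finset.sum_add_distrib,
                Finset.sum_const, Finset.card_univ, nsmul_eq_mul]
              have := hFE t s
              linear_combination (-(B * β)) * this + (B * β *
                fieldError J (meanField J (v t)) s + ((B * β * (B * g)) ^ 2 +
                  4 * B ^ 2 * g) + η / 4) * hcard
      rw [Finset.sum_add_distrib, mul_add] at h2
      rw [e, hΦapp]
      simp only [Φ']
      have hBβ : 0 ≤ B * β := mul_nonneg hB hβ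
      have h3 := hQnn G t s
      have h4 := hFEnn t s
      have h5 := mul_nonneg hBβ h3
      have h6 := mul_nonneg hBβ hη
      nlinarith) ht
  have hcp : ∀ t s, (coloredPairing a α s (fun i => G i) - ∑ i, ∫ r, G i r * v t i r) ^ 2 =
      Q G t s := fun t s => by rw [coloredPairing_eq]
  simp_rw [hcp]
  rw [← hΦapp]
  refine le_trans (Finset.sum_le_sum fun s _ => ?_) hmain
  refine mul_le_mul_of_nonneg_left ?_ (hq t ht s)
  rw [hΦapp]
  linarith [hFEnn t s]

end MomentBound

/-! ### Passage to the limit for a typical field -/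

section Limits

variable {d : ℕ}

lemma tendsto_inv_pow_zero (hd : 0 < d) :
    Tendsto (fun k : ℕ => (((2 * k + 1 : ℕ) : ℝ)⁻¹) ^ d) atTop (𝓝 0) := by
  have h : Tendsto (fun k : ℕ => (((2 * k + 1 : ℕ) : ℝ)⁻¹)) atTop (𝓝 0) :=
    (tendsto_inv_atTop_zero.comp tendsto_natCast_atTop_atTop).comp
      (tendsto_atTop_mono (fun k => by simp only [id]; omega) tendsto_id)
  simpa [hd.ne'] using h.pow d

lemma eventually_forall_abs_colorError_le {α : (Fin d → ℤ) → ℝ} {a p : ℝ}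
    (h : ∀ H : C(Torus d, ℝ), Tendsto (fun k : ℕ => colorError (2 * k + 1) α a p H) atTop (𝓝 0))
    {X : Type*} [TopologicalSpace X] {Z : Set X} (hZ : IsCompact Z) {W : X → C(Torus d, ℝ)}
    (hW : ContinuousOn W Z) {ε : ℝ} (hε : 0 < ε) :
    ∀ᶠ k : ℕ in atTop, ∀ x ∈ Z, |colorError (2 * k + 1) α a p (W x)| ≤ ε := by
  filter_upwards [eventually_forall_abs_le_of_isCompact
    (F := fun (k : ℕ) H => colorError (2 * k + 1) α a p H)
    (fun k H H' => abs_colorError_sub_le a p H H') h (hZ.image_of_continuousOn hW) hε]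
    with k hk x hx using hk _ (Set.mem_image_of_mem W hx)

/-- The local field at z is the empirical pairing with J(γz - ·). These test functions lie in a
compact subset of C(Λ), on which the convergence of the initial data is uniform. -/
lemma eventually_fieldError_le {m₀ : Torus d → ℝ} (hm₀ : Continuous m₀) (hm₀_le : ∀ r, |m₀ r| ≤ 1)
    {σ : ∀ k : ℕ, SpinConfig d (2 * k + 1)}
    (hσ : ∀ H : Torus d → ℝ, Continuous H →
      Tendsto (fun k => empiricalPairing (σ k) H) atTop (𝓝 (∫ r, H r * m₀ r)))
    (J : C(Torus d, ℝ)) {f : C(Torus d, ℝ)}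
    (hf : ∀ r, f r = ∫ r', kernelSection J r r' * m₀ r') {η : ℝ} (hη : 0 < η) :
    ∀ᶠ k in atTop, fieldError J f (σ k) ≤ η := by
  have hi : ∀ H : C(Torus d, ℝ), Integrable fun r => H r * m₀ r := fun H =>
    Torus.integrable_of_continuous (H.continuous.mul hm₀)
  have hε : 0 < Real.sqrt η := Real.sqrt_pos.2 hη
  filter_upwards [eventually_forall_abs_le_of_isCompact (C := 2)
    (F := fun (k : ℕ) (H : C(Torus d, ℝ)) => empiricalPairing (σ k) H - ∫ r, H r * m₀ r)
    (fun k H H' => by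
      have h : ∀ r, |H r - H' r| ≤ dist H H' := fun r => by
        rw [← Real.dist_eq]; exact ContinuousMap.dist_apply_le_dist r
      have e : (empiricalPairing (σ k) H - ∫ r, H r * m₀ r) -
          (empiricalPairing (σ k) H' - ∫ r, H' r * m₀ r) =
          (((2 * k + 1 : ℕ) : ℝ)⁻¹) ^ d * ∑ x, (H (scaledSite x) - H' (scaledSite x)) *
            spin (σ k) x - ∫ r, (H r - H' r) * m₀ r := by
        simp_rw [sub_mul, Finset.sum_sub_distrib]
        rw [integral_sub (hi H) (hi H')]
        unfold empiricalPairing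
        ring
      rw [e, two_mul (dist H H')]
      refine (abs_sub _ _).trans (add_le_add (abs_inv_pow_mul_sum_le fun x => ?_)
        (Torus.abs_integral_le _ fun r => ?_))
      · rw [abs_mul, abs_spin, mul_one]
        exact h _
      · rw [abs_mul, ← mul_one (dist H H')]
        exact mul_le_mul (h r) (hm₀_le r) (abs_nonneg _) dist_nonneg)
    (fun H => by simpa using (hσ H H.continuous).sub_const (∫ r, H r * m₀ r))
    (isCompact_range (kernelSection J).continuous) hε] with k hk
  refine (le_abs_self _).trans (abs_inv_pow_mul_sum_le fun z => ?_)
  have h := hk _ (Set.mem_range_self (scaledSite z))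
  have e : localField J (σ k) z =
      empiricalPairing (σ k) (kernelSection J (scaledSite z)) := by
    unfold localField empiricalPairing
    rw [Finset.mul_sum]
    refine Finset.sum_congr rfl fun y _ => ?_
    rw [kacPotential, scaledSite_sub, kernelSection_apply]
    ring
  rw [e, hf, abs_pow]
  calc _ ≤ Real.sqrt η ^ 2 := by gcongr
    _ = η := Real.sq_sqrt hη.le

variable {J : C(Torus d, ℝ)} {β θ : ℝ} {a p : Fin 2 → ℝ} {T : ℝ} {v : ℝ → Fin 2 → C(Torus d, ℝ)}
  {α : (Fin d → ℤ) → ℝ}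

/-- Convergence in probability of the colored empirical measures, for a typical field. -/
theorem tendsto_measure_coloredPairing (hd : 0 < d) (ha : a 0 ≠ a 1) (hp : p 0 + p 1 = 1)
    (hα : ∀ x, ∃ i, α x = a i) (hJ : ∀ r, J (-r) = J r) (hβ : 0 ≤ β)
    {m₀ : Torus d → ℝ} (hm₀ : Continuous m₀) (hm₀_le : ∀ r, |m₀ r| ≤ 1)
    (hv0 : ∀ i r, v 0 i r = p i * m₀ r)
    (hv : ∀ t ∈ Set.Icc 0 T,
      HasDerivWithinAt v (-v t + fun i => p i • response β θ (a i) (meanField J (v t)))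
        (Set.Icc 0 T) t)
    {σ : ∀ k : ℕ, SpinConfig d (2 * k + 1)}
    (hσ : ∀ H : Torus d → ℝ, Continuous H →
      Tendsto (fun k => empiricalPairing (σ k) H) atTop (𝓝 (∫ r, H r * m₀ r)))
    (hcolor : ∀ i, ∀ H : C(Torus d, ℝ),
      Tendsto (fun k : ℕ => colorError (2 * k + 1) α (a i) (p i) H) atTop (𝓝 0))
    (hinit : ∀ i, ∀ H : C(Torus d, ℝ), Tendsto (fun k : ℕ =>
      (((2 * k + 1 : ℕ) : ℝ)⁻¹) ^ d * ∑ x : DiscTorus d (2 * k + 1),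
        H (scaledSite x) * colorIndicator α (a i) x * spin (σ k) x)
      atTop (𝓝 (p i * ∫ r, H r * m₀ r)))
    {μ : ∀ k : ℕ, Measure (CadlagPath T (SpinConfig d (2 * k + 1)))}
    (hμ : ∀ k, IsMarkovChainLaw (glauberGenerator β J θ α) (σ k) (μ k))
    (t : Set.Icc (0 : ℝ) T) {δ : ℝ} (hδ : 0 < δ) (G : Fin 2 → C(Torus d, ℝ)) :
    Tendsto (fun k => μ k {w | δ ≤ |coloredPairing a α (w.1 t) (fun i => G i)
      - ∑ i, ∫ r, G i r * v t i r|}) atTop (𝓝 0) := by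
  set B : ℝ := ‖J‖ + ‖G 0‖ + ‖G 1‖ with hBdef
  have hJB : ‖J‖ ≤ B := by
    have := norm_nonneg (G 0); have := norm_nonneg (G 1); linarith
  have hGB : ∀ i, ‖G i‖ ≤ B := by
    have h0 := norm_nonneg (G 0)
    have h1 := norm_nonneg (G 1)
    have h2 := norm_nonneg J
    intro i
    fin_cases i
    · simp only [Fin.zero_eta]; linarith
    · simp only [Fin.mk_one]; linarith
  have hB : 0 ≤ B := (norm_nonneg J).trans hJB
  set E : ℕ → ℝ := fun k => ∑ s, NormedSpace.exp
    ((t : ℝ) • LinearMap.toMatrix' (glauberGenerator β J θ α)) (σ k) s *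
      (coloredPairing a α s (fun i => G i) - ∑ i, ∫ r, G i r * v t i r) ^ 2 with hE
  have hvc : ContinuousOn v (Set.Icc 0 T) := fun t ht => (hv t ht).continuousWithinAt
  have hres : ∀ i, ContinuousOn (fun t => response β θ (a i) (meanField J (v t)))
      (Set.Icc 0 T) := fun i =>
    ((continuous_response β θ (a i)).comp (continuous_meanField J)).comp_continuousOn hvc
  have hlim : Tendsto E atTop (𝓝 0) := by
    rw [Metric.tendsto_nhds]
    intro ε hε
    set A : ℝ := Real.exp ((3 * (B * β) + 1) * t) with hA
    have hA0 : 0 < A := Real.exp_pos _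
    -- Three terms of size at most η remain after Grönwall; the fourth makes the inequality strict.
    set η : ℝ := ε / (4 * A) with hη
    have hη0 : 0 < η := by positivity
    set κ : ℝ := Real.sqrt (η / 4) with hκ
    have hκ0 : 0 < κ := Real.sqrt_pos.2 (by positivity)
    have hκ2 : κ ^ 2 = η / 4 := Real.sq_sqrt (by positivity)
    have hsum : ∀ u : Fin 2 → ℝ, (∀ i, |u i| ≤ κ / 2) → (∑ i, u i) ^ 2 ≤ η / 4 := by
      intro u hu
      rw [← hκ2, ← sq_abs, Fin.sum_univ_two]
      have := (abs_add_le (u 0) (u 1)).trans (add_le_add (hu 0) (hu 1))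
      rw [add_halves] at this
      gcongr
    have hg : ∀ᶠ k : ℕ in atTop, 2 * ((B * β * (B * (((2 * k + 1 : ℕ) : ℝ)⁻¹) ^ d)) ^ 2 +
        4 * B ^ 2 * (((2 * k + 1 : ℕ) : ℝ)⁻¹) ^ d) ≤ η / 2 := by
      have hcont : Continuous fun g : ℝ => 2 * ((B * β * (B * g)) ^ 2 + 4 * B ^ 2 * g) := by
        fun_prop
      have h := (hcont.tendsto 0).comp (tendsto_inv_pow_zero hd)
      simp only [mul_zero, ne_eq, OfNat.ofNat_ne_zero, not_false_eq_true, zero_pow,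
        add_zero] at h
      exact (h.eventually (gt_mem_nhds (by positivity : 0 < η / 2))).mono fun k hk => hk.le
    -- Uniformity in r as well as s is required, since the drift bound is applied at every site z
    -- and every time.
    have hRJ : ∀ᶠ k : ℕ in atTop, ∀ i, ∀ q ∈ Set.Icc 0 T ×ˢ (Set.univ : Set (Torus d)),
        |colorError (2 * k + 1) α (a i) (p i)
          (kernelSection J q.2 * response β θ (a i) (meanField J (v q.1)))| ≤ κ / 2 :=
      eventually_all.2 fun i => eventually_forall_abs_colorError_le (hcolor i)
        (isCompact_Icc.prod isCompact_univ)
        (((kernelSection J).continuous.comp continuous_snd).continuousOn.mul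
          ((hres i).comp continuousOn_fst fun q hq => hq.1)) (by positivity)
    have hRG : ∀ᶠ k : ℕ in atTop, ∀ i, ∀ s ∈ Set.Icc 0 T,
        |colorError (2 * k + 1) α (a i) (p i)
          (G i * response β θ (a i) (meanField J (v s)))| ≤ κ / 2 :=
      eventually_all.2 fun i => eventually_forall_abs_colorError_le (hcolor i)
        isCompact_Icc (continuousOn_const.mul (hres i)) (by positivity)
    have hF : ∀ᶠ k in atTop, fieldError J (meanField J (v 0)) (σ k) ≤ η := by
      refine eventually_fieldError_le hm₀ hm₀_le hσ J (fun r => ?_) hη0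
      rw [meanField_apply, torusConv]
      refine integral_congr_ae (Eventually.of_forall fun r' => ?_)
      simp only [hv0, kernelSection_apply]
      rw [← add_mul, hp, one_mul]
    have hY : ∀ᶠ k in atTop, (coloredPairing a α (σ k) (fun i => G i)
        - ∑ i, ∫ r, G i r * v 0 i r) ^ 2 < η := by
      have h1 : Tendsto (fun k => coloredPairing a α (σ k) (fun i => G i)) atTop
          (𝓝 (∑ i, ∫ r, G i r * v 0 i r)) := by
        have e : ∀ i, ∫ r, G i r * v 0 i r = p i * ∫ r, G i r * m₀ r := by
          intro i
          rw [← integral_const_mul]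
          exact integral_congr_ae (Eventually.of_forall fun r => by simp only [hv0]; ring)
        simp_rw [e]
        exact tendsto_finsetSum _ fun i _ => hinit i (G i)
      have h2 := (h1.sub_const (∑ i, ∫ r, G i r * v 0 i r)).pow 2
      simp only [sub_self, ne_eq, OfNat.ofNat_ne_zero, not_false_eq_true, zero_pow] at h2
      exact h2.eventually (gt_mem_nhds hη0)
    filter_upwards [hg, hRJ, hRG, hF, hY] with k hgk hRJk hRGk hFk hYk
    have hbound := sum_exp_mul_sq_le ha hα hJ hβ hv G hJB hGB
      (fun s hs s' => (hμ k).exp_nonneg hs s') hη0.le hgk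
      (fun s hs r => hsum _ fun i => hRJk i (s, r) ⟨hs, trivial⟩)
      (fun s hs => hsum _ fun i => hRGk i s hs) t.2
    have hE0 : 0 ≤ E k := Finset.sum_nonneg fun s _ =>
      mul_nonneg ((hμ k).exp_nonneg t.2 s) (sq_nonneg _)
    rw [Real.dist_eq, sub_zero, abs_of_nonneg hE0]
    calc E k ≤ A * (η + η + η) := hbound.trans (by gcongr)
      _ < A * (4 * η) := by gcongr; linarith
      _ = ε := by rw [hη]; field_simp
  have hlim2 : Tendsto (fun k => ENNReal.ofReal (E k / δ ^ 2)) atTop (𝓝 0) := by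
    have := ENNReal.tendsto_ofReal (hlim.div_const (δ ^ 2))
    simpa using this
  exact tendsto_of_tendsto_of_tendsto_of_le_of_le tendsto_const_nhds hlim2
    (fun k => zero_le) fun k => (hμ k).measure_le_abs_eval t
      (fun s => coloredPairing a α s (fun i => G i) - ∑ i, ∫ r, G i r * v t i r) hδ

/-- As p₀ + p₁ = 1, the two disjoint color events exhaust the probability; there are countably many
sites. -/
lemma ae_forall_exists_color {Ω : Type*} [MeasurableSpace Ω] {P : Measure Ω}
    [IsProbabilityMeasure P] (ha : a 0 ≠ a 1) (hp : p 0 + p 1 = 1)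
    {α : (Fin d → ℤ) → Ω → ℝ} (hα : ∀ x, Measurable (α x))
    (hαlaw : ∀ x i, P.real {ω | α x ω = a i} = p i) :
    ∀ᵐ ω ∂P, ∀ x, ∃ i, α x ω = a i := by
  refine ae_all_iff.2 fun x => ?_
  have hm : ∀ i, MeasurableSet {ω | α x ω = a i} := fun i =>
    hα x (measurableSet_singleton (a i))
  have hdisj : Disjoint {ω | α x ω = a 0} {ω | α x ω = a 1} :=
    Set.disjoint_left.2 fun ω h0 h1 => ha (h0.symm.trans h1)
  have h1 : P.real ({ω | α x ω = a 0} ∪ {ω | α x ω = a 1}) = 1 := by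
    rw [measureReal_union hdisj (hm 1), hαlaw, hαlaw, hp]
  rw [measureReal_def, ENNReal.toReal_eq_one_iff] at h1
  filter_upwards [(mem_ae_iff_prob_eq_one ((hm 0).union (hm 1))).2 h1] with ω hω
  rcases hω with h | h
  · exact ⟨0, h⟩
  · exact ⟨1, h⟩

end Limits

theorem theorem2p5 {Ω : Type*} [MeasurableSpace Ω] (P : Measure Ω) [IsProbabilityMeasure P]
    (d : ℕ) (hd : 0 < d) (T : ℝ) (hT : 0 < T) (β : ℝ) (hβ : 0 < β) (θ : ℝ) (hθ : 0 < θ)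
    (J : Torus d → ℝ) (hJ : TorusC1 J) (hJsymm : ∀ r, J (-r) = J r) (hJint : ∫ r, J r = 1)
    (a p : Fin 2 → ℝ) (ha : a 0 ≠ a 1) (hp : p 0 + p 1 = 1)
    -- the i.i.d. random field, with `P(α(x) = a_i) = p_i`
    (α : (Fin d → ℤ) → Ω → ℝ) (hα : ∀ x, Measurable (α x))
    (hαindep : ProbabilityTheory.iIndepFun α P)
    (hαlaw : ∀ x i, P.real {ω | α x ω = a i} = p i)
    -- the initial profile and the initial configurations, with `γ = 1 / (2 k + 1)`
    (m₀ : Torus d → ℝ) (hm₀ : Continuous m₀) (hm₀_le : ∀ r, |m₀ r| ≤ 1)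
    (σ : ∀ k : ℕ, SpinConfig d (2 * k + 1))
    (hσ : ∀ H : Torus d → ℝ, Continuous H →
      Tendsto (fun k => empiricalPairing (σ k) H) atTop (𝓝 (∫ r, H r * m₀ r))) :
    ∃ m : Fin 2 → ℝ → Torus d → ℝ,
      IsWeakSolution T β J θ a p m₀ m ∧
      (∀ m' : Fin 2 → ℝ → Torus d → ℝ, IsWeakSolution T β J θ a p m₀ m' →
        ∀ i, ∀ t ∈ Set.Icc 0 T, m' i t =ᵐ[volume] m i t) ∧
      ∀ᵐ ω ∂P,
        ∀ μ : ∀ k : ℕ, Measure (CadlagPath T (SpinConfig d (2 * k + 1))),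
          (∀ k, IsMarkovChainLaw
            (glauberGenerator β J θ (fun x => α x ω)) (σ k) (μ k)) →
          ∀ (t : Set.Icc (0 : ℝ) T) (δ : ℝ), 0 < δ →
            ∀ G : Fin 2 → Torus d → ℝ, (∀ i, TorusC1 (G i)) →
              Tendsto (fun k => μ k {w |
                  δ ≤ |coloredPairing a (fun x => α x ω) (w.1 t) G
                    - ∑ i, ∫ r, G i r * m i t r|})
                atTop (𝓝 0) := by
  let Jc : C(Torus d, ℝ) := ⟨J, hJ.continuous⟩
  obtain ⟨v, hv0, hv⟩ := exists_limit_flow Jc β θ a p hT.le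
    (fun i => ⟨fun r => p i * m₀ r, by fun_prop⟩)
  have hv0' : ∀ i r, v 0 i r = p i * m₀ r := fun i r => by rw [hv0]; rfl
  have hsol : IsWeakSolution T β Jc θ a p m₀ (fun i t => v t i) :=
    isWeakSolution_of_flow Jc β θ a p hv0' hv
  refine ⟨fun i t => v t i, hsol, fun m' hm' i t ht => hsol.ae_eq hm' i ht, ?_⟩
  -- Weights 1: the hypothesis of the color law is then convergence of Riemann sums.
  have hone : ∀ᵐ ω ∂P, ∀ i, ∀ H : C(Torus d, ℝ), Tendsto (fun k : ℕ =>
      colorError (2 * k + 1) (fun y => α y ω) (a i) (p i) H) atTop (𝓝 0) := by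
    refine ae_all_iff.2 fun i => ?_
    filter_upwards [ae_forall_tendsto_colored_average hd hα hαindep (fun x => hαlaw x i)
      (c := fun k x => 1) (fun k x => by simp) (μ₀ := fun _ => 1)
      (fun H hH => by simpa using tendsto_riemannSum hH)] with ω hω H
    simpa [colorError] using (hω H).sub_const (p i * ∫ r, H r)
  -- Weights σ^γ, allowed because the initial configurations do not depend on the field: the initial
  -- spins split between the colors in proportions p_i.
  have hini : ∀ᵐ ω ∂P, ∀ i, ∀ H : C(Torus d, ℝ), Tendsto (fun k : ℕ =>
      (((2 * k + 1 : ℕ) : ℝ)⁻¹) ^ d * ∑ x : DiscTorus d (2 * k + 1),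
        H (scaledSite x) * colorIndicator (fun y => α y ω) (a i) x * spin (σ k) x)
      atTop (𝓝 (p i * ∫ r, H r * m₀ r)) :=
    ae_all_iff.2 fun i => ae_forall_tendsto_colored_average hd hα hαindep (fun x => hαlaw x i)
      (c := fun k => spin (σ k)) (fun k x => (abs_spin (σ k) x).le) hσ
  filter_upwards [ae_forall_exists_color ha hp hα hαlaw, hone, hini]
    with ω hcol hω hωi μ hμ t δ hδ G hG
  exact tendsto_measure_coloredPairing (J := Jc) hd ha hp hcol hJsymm hβ.le hm₀ hm₀_le hv0' hv hσ
    hω hωi hμ t hδ (fun i => ⟨G i, (hG i).continuous⟩)
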